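/- Let $G$ be a finite simple undirected graph that contains neither $K_5-e$ (the complete graph on five vertices with one edge deleted) nor $K_2\cup 2K_1$ (the disjoint union of a single edge and two isolated vertices) as an induced subgraph. Then $\chi(G)\le\omega(G)+1$, where $\chi(G)$ is the chromatic number of $G$ and $\omega(G)$ is the maximum size of a clique in $G$. -/

import Mathlib

/-- The graph `K₅ - e`: the complete graph on five vertices with one edge deleted. -/
def K5MinusEdge : SimpleGraph (Fin 5) :=
  (⊤ : SimpleGraph (Fin 5)).deleteEdges {s(0, 1)}

/-- The graph `K₂ ∪ 2K₁`: the disjoint union of one edge and two isolated vertices. -/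
def K2Union2K1 : SimpleGraph (Fin 2 ⊕ Fin 2) :=
  SimpleGraph.sum (⊤ : SimpleGraph (Fin 2)) (⊥ : SimpleGraph (Fin 2))

/-! Pass to the complement `H` of `G`. Colour classes become cliques, so the claim is that `H` has a
cover by α(H) + 1 cliques. The excluded graphs become K₄ - e (`DiamondFree`) and K₂ ∪ 3K₁
(`NoEdgeWithTriple`). Everything is stated for a vertex set `S` whose independent subsets have at
most `a` elements, so that pieces can be removed inductively.

Suppose `S` contains a triangle, and let `Q` be a maximum clique. If deleting `Q` lowers the
independence number, induct. Otherwise a maximum independent set avoids `Q`. Each vertex outside `Q`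
has at most one neighbour in `Q`, and counting edges between the two sets forces a = |Q| = 3
(`card_eq_three_of_disjoint`). Then |S| ≤ 10 (`DiamondFree.card_le_ten`), and four cliques suffice
by a direct analysis (`DiamondFree.cliqueCover_four`).

If `S` is triangle-free, a clique cover amounts to a matching together with the unmatched vertices
(`TriangleFreeOn.matchingLE`). Gallai's lemma leaves two essential cases. Either at most one vertex
is unmatched, and the bound |S| ≤ 2a + 2 (`TriangleFreeOn.card_le`) is enough; or `S` splits into
two parts without edges between them, and one part can be matched without the extra +1
(`matchingLE_or_of_separated`). -/

set_option linter.unusedSectionVars false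

/-! ### Independence bounds and clique covers of vertex sets -/

section CliqueCovers

variable {V : Type*} [DecidableEq V] {H : SimpleGraph V} {S T : Finset V}

/-- Every independent subset of `S` has at most `a` elements. -/
def IndepLE (H : SimpleGraph V) (S : Finset V) (a : ℕ) : Prop :=
  ∀ K ⊆ S, H.IsIndepSet (K : Set V) → K.card ≤ a

/-- `S` can be partitioned into at most `k` cliques. -/
def CliqueCover (H : SimpleGraph V) (S : Finset V) (k : ℕ) : Prop :=
  ∃ c : V → ℕ, (∀ x ∈ S, c x < k) ∧ ∀ x ∈ S, ∀ y ∈ S, x ≠ y → c x = c y → H.Adj x y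

/-- No two nonadjacent vertices have two adjacent common neighbours. -/
def DiamondFree (H : SimpleGraph V) : Prop :=
  ∀ ⦃a b c d⦄, H.Adj b c → H.Adj a b → H.Adj a c → H.Adj d b → H.Adj d c → a ≠ d → H.Adj a d

/-- There is no edge together with three pairwise nonadjacent vertices that miss it. -/
def NoEdgeWithTriple (H : SimpleGraph V) : Prop :=
  ∀ ⦃u v x y z⦄, H.Adj u v → x ≠ y → x ≠ z → y ≠ z → ¬ H.Adj x y → ¬ H.Adj x z → ¬ H.Adj y z →
    ¬ H.Adj u x → ¬ H.Adj u y → ¬ H.Adj u z → ¬ H.Adj v x → ¬ H.Adj v y → ¬ H.Adj v z → False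

/-- `S` contains no triangle. -/
def TriangleFreeOn (H : SimpleGraph V) (S : Finset V) : Prop :=
  ∀ ⦃x y z⦄, x ∈ S → y ∈ S → z ∈ S → H.Adj x y → H.Adj x z → H.Adj y z → False

theorem TriangleFreeOn.mono (h : TriangleFreeOn H S) (hT : T ⊆ S) : TriangleFreeOn H T :=
  fun _ _ _ hx hy hz => h (hT hx) (hT hy) (hT hz)

theorem IndepLE.mono {a b : ℕ} (h : IndepLE H S a) (hT : T ⊆ S) (hab : a ≤ b) : IndepLE H T b :=
  fun K hK hi => (h K (hK.trans hT) hi).trans hab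

theorem exists_indepLE (H : SimpleGraph V) (S : Finset V) :
    ∃ K ⊆ S, H.IsIndepSet (K : Set V) ∧ IndepLE H S K.card := by
  classical
  obtain ⟨K, hK, hmax⟩ := (S.powerset.filter fun K : Finset V => H.IsIndepSet (K : Set V)).exists_max_image
    Finset.card ⟨∅, by simp⟩
  simp only [Finset.mem_filter, Finset.mem_powerset] at hK hmax
  exact ⟨K, hK.1, hK.2, fun L hL hi => hmax L ⟨hL, hi⟩⟩

theorem IndepLE.adj_of_two (h : IndepLE H S 2) {x y z : V} (hx : x ∈ S) (hy : y ∈ S) (hz : z ∈ S)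
    (hxy : x ≠ y) (hxz : x ≠ z) (hyz : y ≠ z) : H.Adj x y ∨ H.Adj x z ∨ H.Adj y z := by
  by_contra! hc
  have := h {x, y, z} (by simp [Finset.insert_subset_iff, *]) (by
    intro a ha b hb _
    simp only [Finset.coe_insert, Finset.coe_singleton, Set.mem_insert_iff,
      Set.mem_singleton_iff] at ha hb
    have := hc.1; have := hc.2.1; have := hc.2.2
    rcases ha with rfl | rfl | rfl <;> rcases hb with rfl | rfl | rfl <;> simp_all [H.adj_comm])
  rw [Finset.card_eq_three.2 ⟨x, y, z, hxy, hxz, hyz, rfl⟩] at this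
  omega

theorem indepLE_two (h : ∀ x ∈ S, ∀ y ∈ S, ∀ z ∈ S, x ≠ y → x ≠ z → y ≠ z →
    ¬ H.Adj x y → ¬ H.Adj x z → ¬ H.Adj y z → False) : IndepLE H S 2 := by
  intro K hK hi
  by_contra! hc
  obtain ⟨x, y, z, hx, hy, hz, hxy, hxz, hyz⟩ := Finset.two_lt_card_iff.1 hc
  exact h x (hK hx) y (hK hy) z (hK hz) hxy hxz hyz (hi hx hy hxy) (hi hx hz hxz) (hi hy hz hyz)

theorem card_four {x y z w : V} (hxy : x ≠ y) (hxz : x ≠ z) (hxw : x ≠ w) (hyz : y ≠ z)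
    (hyw : y ≠ w) (hzw : z ≠ w) : ({x, y, z, w} : Finset V).card = 4 := by
  rw [Finset.card_insert_of_notMem (by simp [*]), Finset.card_eq_three.2 ⟨y, z, w, hyz, hyw, hzw, rfl⟩]

theorem IndepLE.four_le {a : ℕ} (h : IndepLE H S a) {x y z w : V} (hx : x ∈ S) (hy : y ∈ S)
    (hz : z ∈ S) (hw : w ∈ S) (hxy : x ≠ y) (hxz : x ≠ z) (hxw : x ≠ w) (hyz : y ≠ z)
    (hyw : y ≠ w) (hzw : z ≠ w) (h1 : ¬ H.Adj x y) (h2 : ¬ H.Adj x z) (h3 : ¬ H.Adj x w)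
    (h4 : ¬ H.Adj y z) (h5 : ¬ H.Adj y w) (h6 : ¬ H.Adj z w) : 4 ≤ a := by
  have := h {x, y, z, w} (by simp [Finset.insert_subset_iff, *]) (by
    intro a ha b hb _
    simp only [Finset.coe_insert, Finset.coe_singleton, Set.mem_insert_iff,
      Set.mem_singleton_iff] at ha hb
    rcases ha with rfl | rfl | rfl | rfl <;> rcases hb with rfl | rfl | rfl | rfl <;>
      simp_all [H.adj_comm])
  rwa [card_four hxy hxz hxw hyz hyw hzw] at this

theorem IndepLE.three_le {a : ℕ} (h : IndepLE H S a) {x y z : V} (hx : x ∈ S) (hy : y ∈ S)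
    (hz : z ∈ S) (hxy : x ≠ y) (hxz : x ≠ z) (hyz : y ≠ z) (h1 : ¬ H.Adj x y) (h2 : ¬ H.Adj x z)
    (h3 : ¬ H.Adj y z) : 3 ≤ a := by
  by_contra! hc
  rcases (h.mono subset_rfl (by omega : a ≤ 2)).adj_of_two hx hy hz hxy hxz hyz with h | h | h <;>
    contradiction

theorem CliqueCover.mono {k l : ℕ} (h : CliqueCover H S k) (hT : T ⊆ S) (hkl : k ≤ l) :
    CliqueCover H T l := by
  obtain ⟨c, h1, h2⟩ := h
  exact ⟨c, fun x hx => (h1 x (hT hx)).trans_le hkl, fun x hx y hy => h2 x (hT hx) y (hT hy)⟩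

theorem CliqueCover.union {k l : ℕ} (h : CliqueCover H S k) (h' : CliqueCover H T l) :
    CliqueCover H (S ∪ T) (k + l) := by
  obtain ⟨c, h1, h2⟩ := h
  obtain ⟨d, h3, h4⟩ := h'
  refine ⟨fun x => if x ∈ S then c x else k + d x, fun x hx => ?_, fun x hx y hy hne => ?_⟩
  · by_cases hS : x ∈ S
    · simpa [hS] using (h1 x hS).trans_le (by omega)
    · simpa [hS] using h3 x (by simpa [hS] using hx)
  · by_cases hS : x ∈ S <;> by_cases hS' : y ∈ S <;> simp only [hS, hS', if_true, if_false] <;>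
      intro he
    · exact h2 x hS y hS' hne he
    · have := h1 x hS; omega
    · have := h1 y hS'; omega
    · exact h4 x (by simpa [hS] using hx) y (by simpa [hS'] using hy) hne (by omega)

theorem cliqueCover_one (h : H.IsClique (S : Set V)) : CliqueCover H S 1 :=
  ⟨fun _ => 0, by simp, fun _ hx _ hy hne _ => h hx hy hne⟩

theorem CliqueCover.add_clique {k : ℕ} {Q : Finset V} (hQ : H.IsClique (Q : Set V))
    (h : CliqueCover H (S \ Q) k) : CliqueCover H S (k + 1) :=
  (h.union (cliqueCover_one hQ)).mono (by simp) le_rfl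

theorem cliqueCover_zero : CliqueCover H ∅ 0 := ⟨fun _ => 0, by simp, by simp⟩

theorem cliqueCover_card {k : ℕ} (h : S.card ≤ k) : CliqueCover H S k := by
  induction k generalizing S with
  | zero => rw [Finset.card_eq_zero.1 (by omega : S.card = 0)]; exact cliqueCover_zero
  | succ k ih =>
    rcases S.eq_empty_or_nonempty with rfl | ⟨x, hx⟩
    · exact cliqueCover_zero.mono subset_rfl (by omega)
    · refine CliqueCover.add_clique (Q := {x}) (by simp) (ih ?_)
      rw [Finset.card_sdiff_of_subset (by simpa using hx)]
      simp; omega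

theorem SimpleGraph.Adj.isClique_pair {x y : V} (h : H.Adj x y) :
    H.IsClique (({x, y} : Finset V) : Set V) := by
  simp [SimpleGraph.isClique_iff, Set.pairwise_insert, h, h.symm]

end CliqueCovers

/-! ### Matchings as involutions, and Gallai's lemma -/

section Matchings

variable {V : Type*} [DecidableEq V] {H : SimpleGraph V} {S T : Finset V} {f g : V → V}

/-- The involution `f` matches vertices of `S` along edges and fixes all other vertices. -/
structure IsMatchingOn (H : SimpleGraph V) (S : Finset V) (f : V → V) : Prop where
  invol : Function.Involutive f
  adj : ∀ x, f x = x ∨ H.Adj x (f x)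
  fix : ∀ x, x ∉ S → f x = x

/-- The number of vertices of `S` that `f` leaves unmatched. -/
def unmatched (S : Finset V) (f : V → V) : ℕ := (S.filter fun x => f x = x).card

/-- Some matching of `S` has at most `k` matched pairs and unmatched vertices in total. -/
def MatchingLE (H : SimpleGraph V) (S : Finset V) (k : ℕ) : Prop :=
  ∃ f, IsMatchingOn H S f ∧ S.card + unmatched S f ≤ 2 * k

theorem even_card_of_fixedPointFree (A : Finset V) (g : V → V)
    (h : ∀ x ∈ A, g x ∈ A ∧ g x ≠ x ∧ g (g x) = x) : Even A.card := by
  have : ∑ x ∈ A, (1 : ZMod 2) = 0 :=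
    Finset.sum_involution (fun x _ => g x) (fun _ _ => by decide) (fun x hx _ => (h x hx).2.1)
      (fun x hx => (h x hx).1) (fun x hx => (h x hx).2.2)
  simp only [Finset.sum_const, nsmul_eq_mul, mul_one] at this
  exact (ZMod.natCast_eq_zero_iff_even).1 this

namespace IsMatchingOn

theorem mem (h : IsMatchingOn H S f) {x : V} (hx : x ∈ S) : f x ∈ S := by
  by_contra hc
  have := h.fix _ hc
  rw [h.invol] at this
  exact hc (this ▸ hx)

/-- Matched vertices come in pairs. This parity later absorbs several off-by-one losses. -/
theorem even_card_add (h : IsMatchingOn H S f) : Even (S.card + unmatched S f) := by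
  have h1 : Even (S.filter fun x => ¬ f x = x).card := by
    refine even_card_of_fixedPointFree _ f fun x hx => ?_
    simp only [Finset.mem_filter] at hx ⊢
    refine ⟨⟨h.mem hx.1, ?_⟩, hx.2, h.invol x⟩
    rw [h.invol]; exact fun e => hx.2 e.symm
  have h2 := Finset.card_filter_add_card_filter_not (s := S) (fun x => f x = x)
  unfold unmatched
  obtain ⟨r, hr⟩ := h1
  exact ⟨(S.filter fun x => f x = x).card + r, by omega⟩

theorem id (H : SimpleGraph V) (S : Finset V) : IsMatchingOn H S id :=
  ⟨fun _ => rfl, fun _ => Or.inl rfl, fun _ _ => rfl⟩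

theorem mono (h : IsMatchingOn H S f) (hT : S ⊆ T) : IsMatchingOn H T f :=
  ⟨h.invol, h.adj, fun x hx => h.fix x fun hS => hx (hT hS)⟩

/-- Adding an edge between two unmatched vertices. -/
theorem add_edge (h : IsMatchingOn H S f) {u v : V} (hu : u ∈ S) (hv : v ∈ S) (huv : H.Adj u v)
    (hfu : f u = u) (hfv : f v = v) :
    ∃ g, IsMatchingOn H S g ∧ unmatched S g + 2 = unmatched S f := by
  have hne := huv.ne
  have key : ∀ x, x ≠ u → x ≠ v → f x ≠ u ∧ f x ≠ v := fun x h1 h2 =>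
    ⟨fun e => h1 (by rw [← h.invol x, e, hfu]), fun e => h2 (by rw [← h.invol x, e, hfv])⟩
  refine ⟨fun x => if x = u then v else if x = v then u else f x, ⟨fun x => ?_, fun x => ?_,
    fun x hx => ?_⟩, ?_⟩
  · by_cases h1 : x = u
    · simp [h1, hne.symm]
    · by_cases h2 : x = v
      · simp [h2, hne.symm]
      · simp [h1, h2, key x h1 h2, h.invol x]
  · by_cases h1 : x = u
    · simp [h1, huv]
    · by_cases h2 : x = v
      · simp [h2, hne.symm, huv.symm]
      · simpa [h1, h2] using h.adj x
  · have h1 : x ≠ u := fun e => hx (e ▸ hu)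
    have h2 : x ≠ v := fun e => hx (e ▸ hv)
    simpa [h1, h2] using h.fix x hx
  · have : (S.filter fun x => f x = x) =
        insert u (insert v (S.filter fun x => (if x = u then v else if x = v then u else f x) = x)) := by
      ext x
      simp only [Finset.mem_filter, Finset.mem_insert]
      by_cases h1 : x = u
      · subst h1; simp [hu, hfu]
      · by_cases h2 : x = v
        · subst h2; simp [hv, hfv]
        · simp [h1, h2]
    unfold unmatched
    rw [this, Finset.card_insert_of_notMem, Finset.card_insert_of_notMem]
    · simp [hne.symm, hne]
    · simp [hne, hne.symm]

/-- Recombining two matchings along a set that both preserve. -/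
theorem piecewise (hf : IsMatchingOn H S f) (hg : IsMatchingOn H S g) (p : V → Prop)
    [DecidablePred p] (hpf : ∀ x, p x → p (f x)) (hpg : ∀ x, p x → p (g x)) :
    IsMatchingOn H S fun x => if p x then g x else f x := by
  refine ⟨fun x => ?_, fun x => ?_, fun x hx => ?_⟩
  · by_cases hx : p x
    · simp [hx, hpg x hx, hg.invol x]
    · have : ¬ p (f x) := fun h => hx (by simpa [hf.invol x] using hpf _ h)
      simp [hx, this, hf.invol x]
  · by_cases hx : p x
    · simpa [hx] using hg.adj x
    · simpa [hx] using hf.adj x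
  · by_cases h : p x
    · simpa [h] using hg.fix x hx
    · simpa [h] using hf.fix x hx

end IsMatchingOn

/-- The two complementary recombinations share out the same fixed points. Hence, if `f` and `g` are
optimal and both recombinations are matchings, both are optimal too. -/
theorem unmatched_piecewise_add (S : Finset V) (f g : V → V) (p : V → Prop) [DecidablePred p] :
    unmatched S (fun x => if p x then g x else f x) +
      unmatched S (fun x => if p x then f x else g x) = unmatched S f + unmatched S g := by
  simp only [unmatched, Finset.card_filter, ← Finset.sum_add_distrib]
  refine Finset.sum_congr rfl fun x _ => ?_
  by_cases h : p x <;> simp [h, add_comm]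

theorem exists_isMatchingOn_min (H : SimpleGraph V) (S : Finset V) :
    ∃ f, IsMatchingOn H S f ∧ ∀ g, IsMatchingOn H S g → unmatched S f ≤ unmatched S g := by
  classical
  have hex : ∃ n f, IsMatchingOn H S f ∧ unmatched S f = n := ⟨_, _, IsMatchingOn.id H S, rfl⟩
  obtain ⟨f, hf, he⟩ := Nat.find_spec hex
  exact ⟨f, hf, fun g hg => he ▸ Nat.find_min' hex ⟨g, hg, rfl⟩⟩

/-- An orbit of the dihedral group generated by two involutions contains at most two fixed points
of the generators, counted with multiplicity. -/
theorem eq_of_sameCycle_of_fixed {f g : Equiv.Perm V} (hf : f * f = 1) (hg : g * g = 1) {t u v : V}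
    (ht : g t = t) (hu : f u = u) (hv : f v = v) (htu : (f * g).SameCycle t u)
    (htv : (f * g).SameCycle t v) : u = v := by
  have hfi : f⁻¹ = f := inv_eq_of_mul_eq_one_left hf
  have hgi : g⁻¹ = g := inv_eq_of_mul_eq_one_left hg
  -- Conjugation by either reflection inverts the rotation `f * g`.
  have hconj : ∀ i : ℤ, f * (f * g) ^ i = (f * g) ^ (-i) * f := fun i => by
    have h1 : f * (f * g) * f⁻¹ = (f * g)⁻¹ := by
      rw [mul_inv_rev, hfi, hgi, ← mul_assoc, hf, one_mul]
    have h2 : f * (f * g) ^ i * f⁻¹ = (f * g) ^ (-i) := by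
      rw [← conj_zpow, h1, inv_zpow, zpow_neg]
    rw [← h2]; group
  have hft : f t = (f * g) t := by simp [ht]
  -- With σ = f * g and `g t = t`, the reflection `f` sends σ^i t to σ^(1-i) t, so a fixed point of
  -- `f` at position i makes 1 - 2i a period of `t`.
  have key : ∀ (w : V) (i : ℤ), f w = w → ((f * g) ^ i) t = w → ((f * g) ^ (1 - 2 * i)) t = t := by
    intro w i hw hi
    have h1 : f (((f * g) ^ i) t) = ((f * g) ^ (1 - i)) t := by
      rw [← Equiv.Perm.mul_apply, hconj, Equiv.Perm.mul_apply, hft, ← Equiv.Perm.mul_apply,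
        ← zpow_add_one]
      congr 2; ring
    rw [hi, hw] at h1
    rw [show (1 - 2 * i : ℤ) = -i + (1 - i) by ring, zpow_add, Equiv.Perm.mul_apply, ← h1, ← hi,
      ← Equiv.Perm.mul_apply, ← zpow_add]
    simp
  obtain ⟨i, hi⟩ := htu
  obtain ⟨j, hj⟩ := htv
  have h1 := key u i hu hi
  have h2 := key v j hv hj
  set σ := f * g
  have hpow : ∀ (a b : ℤ), (σ ^ a) t = t → (σ ^ (a * b)) t = t := fun a b h => by
    rw [zpow_mul]
    exact Equiv.Perm.zpow_apply_eq_self_of_apply_eq_self h b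
  -- The two odd periods differ by the even period 2(j - i). Combined with the odd period 1 - 2i, it
  -- yields the period j - i itself.
  have h3 : (σ ^ (2 * (j - i))) t = t := by
    rw [show 2 * (j - i) = (1 - 2 * i) - (1 - 2 * j) by ring, zpow_sub, Equiv.Perm.mul_apply,
      Equiv.Perm.inv_eq_iff_eq.2 h2.symm, h1]
  have h4 : (σ ^ (j - i)) t = t := by
    rw [show j - i = (1 - 2 * i) * (j - i) + 2 * (j - i) * i by ring, zpow_add,
      Equiv.Perm.mul_apply, hpow _ _ h3, hpow _ _ h1]
  rw [← hi, ← hj, show j = i + (j - i) by ring, zpow_add, Equiv.Perm.mul_apply, h4]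

/-- If two optimal matchings miss `u, v` and `t` respectively, then some optimal matching misses
`t` and one of `u, v`. -/
theorem exists_optimal_missing (hf : IsMatchingOn H S f) (hg : IsMatchingOn H S g)
    (hfm : ∀ h, IsMatchingOn H S h → unmatched S f ≤ unmatched S h)
    (hgm : ∀ h, IsMatchingOn H S h → unmatched S g ≤ unmatched S h) {t u v : V} (huv : u ≠ v)
    (ht : g t = t) (hu : f u = u) (hv : f v = v) :
    ∃ h, IsMatchingOn H S h ∧ unmatched S h = unmatched S f ∧ h t = t ∧ (h u = u ∨ h v = v) := by
  classical
  let F : Equiv.Perm V := hf.invol.toPerm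
  let G : Equiv.Perm V := hg.invol.toPerm
  have hF : F * F = 1 := Equiv.ext hf.invol
  have hG : G * G = 1 := Equiv.ext hg.invol
  have hGi : G⁻¹ = G := inv_eq_of_mul_eq_one_left hG
  have hFi : F⁻¹ = F := inv_eq_of_mul_eq_one_left hF
  -- The rotation orbit of `t` is the full dihedral orbit because `g` fixes `t`; hence both
  -- involutions preserve it.
  let p : V → Prop := fun x => (F * G).SameCycle t x
  have hpg : ∀ x, p x → p (g x) := by
    rintro x ⟨i, rfl⟩
    refine ⟨-i, ?_⟩
    have h1 : G * (F * G) * G⁻¹ = (F * G)⁻¹ := by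
      rw [mul_inv_rev, hFi, hGi]; simp [mul_assoc, hG]
    have h2 : G * (F * G) ^ i * G⁻¹ = (F * G) ^ (-i) := by
      rw [← conj_zpow, h1, inv_zpow, zpow_neg]
    rw [← h2, hGi]
    show G (((F * G) ^ i) (g t)) = _
    rw [ht]; rfl
  have hpf : ∀ x, p x → p (f x) := by
    intro x hx
    have h1 : p (g x) := hpg x hx
    have h2 : p ((F * G) (g x)) := Equiv.Perm.sameCycle_apply_right.2 h1
    have h3 : (F * G) (g x) = f x := by
      show f (g (g x)) = f x
      rw [hg.invol]
    rwa [h3] at h2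
  refine ⟨fun x => if p x then g x else f x, hf.piecewise hg p hpf hpg, ?_, ?_, ?_⟩
  · have h1 := hfm _ (hf.piecewise hg p hpf hpg)
    have h2 := hgm _ (hg.piecewise hf p hpg hpf)
    have h3 := unmatched_piecewise_add S f g p
    omega
  · have : p t := Equiv.Perm.SameCycle.refl _ _
    simp [this, ht]
  · by_contra! hc
    have h1 : p u := by by_contra h; exact hc.1 (by simp [h, hu])
    have h2 : p v := by by_contra h; exact hc.2 (by simp [h, hv])
    exact huv (eq_of_sameCycle_of_fixed hF hG (t := t) ht hu hv h1 h2)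

/-- **Gallai's lemma**: if every vertex of `S` is missed by an optimal matching, then an optimal
matching misses at most one vertex or `S` splits into two parts without edges between them. -/
theorem gallai_split (hf : IsMatchingOn H S f)
    (hfm : ∀ h, IsMatchingOn H S h → unmatched S f ≤ unmatched S h)
    (hall : ∀ t ∈ S, ∃ g, IsMatchingOn H S g ∧ unmatched S g = unmatched S f ∧ g t = t)
    (h2 : 2 ≤ unmatched S f) :
    ∃ C ⊆ S, C.Nonempty ∧ (S \ C).Nonempty ∧ ∀ x ∈ C, ∀ y ∈ S \ C, ¬ H.Adj x y := by
  classical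
  obtain ⟨u, v, hu, hv, huv⟩ := Finset.one_lt_card_iff.1 h2
  simp only [Finset.mem_filter] at hu hv
  -- `r x y` says that no optimal matching misses both of two distinct vertices. It holds along
  -- edges and is transitive on `S`, so the class of `u` has no edge leaving it; `v` lies outside,
  -- since `f` misses both.
  let r : V → V → Prop := fun x y =>
    ∀ g, IsMatchingOn H S g → unmatched S g = unmatched S f → g x = x → g y = y → x = y
  have hadj : ∀ x ∈ S, ∀ y ∈ S, H.Adj x y → r x y := by
    intro x hx y hy hxy g hg he hgx hgy
    obtain ⟨k, hk, hk'⟩ := hg.add_edge hx hy hxy hgx hgy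
    have := hfm k hk
    omega
  have htrans : ∀ x, ∀ y ∈ S, ∀ z, r x y → r y z → r x z := by
    intro x y hy z hxy hyz g hg he hgx hgz
    by_contra hne
    obtain ⟨k, hk, hke, hky⟩ := hall y hy
    obtain ⟨l, hl, hle, hly, hlxz⟩ := exists_optimal_missing hg hk
      (fun h hh => he ▸ hfm h hh) (fun h hh => hke ▸ hfm h hh) hne hky hgx hgz
    rcases hlxz with h | h
    · have e := hxy l hl (hle.trans he) h hly
      exact hne (e.trans (hyz g hg he (e ▸ hgx) hgz))
    · have e := hyz l hl (hle.trans he) hly h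
      exact hne (hxy g hg he hgx (e ▸ hgz) |>.trans e)
  refine ⟨S.filter fun x => r u x, Finset.filter_subset _ _, ⟨u, ?_⟩, ⟨v, ?_⟩, ?_⟩
  · simp only [Finset.mem_filter]
    exact ⟨hu.1, fun _ _ _ _ _ => rfl⟩
  · simp only [Finset.mem_sdiff, Finset.mem_filter, not_and]
    exact ⟨hv.1, fun _ h => huv (h f hf rfl hu.2 hv.2)⟩
  · intro x hx y hy hxy
    simp only [Finset.mem_sdiff, Finset.mem_filter, not_and] at hx hy
    exact hy.2 hy.1 (htrans u x hx.1 y hx.2 (hadj x hx.1 y hy.1 hxy))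

theorem MatchingLE.mono_right {k l : ℕ} (h : MatchingLE H S k) (hkl : k ≤ l) : MatchingLE H S l := by
  obtain ⟨f, hf, h⟩ := h
  exact ⟨f, hf, by omega⟩

theorem MatchingLE.union {k l : ℕ} (h : MatchingLE H S k) (h' : MatchingLE H T l)
    (hd : Disjoint S T) : MatchingLE H (S ∪ T) (k + l) := by
  obtain ⟨f, hf, hk⟩ := h
  obtain ⟨g, hg, hl⟩ := h'
  refine ⟨fun x => if x ∈ T then g x else f x,
    (hf.mono Finset.subset_union_left).piecewise (hg.mono Finset.subset_union_right) (· ∈ T)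
      (fun x hx => ?_) (fun x hx => hg.mem hx), ?_⟩
  · rw [hf.fix x (Finset.disjoint_right.1 hd hx)]; exact hx
  · have h1 : unmatched (S ∪ T) (fun x => if x ∈ T then g x else f x) =
        unmatched S f + unmatched T g := by
      unfold unmatched
      rw [Finset.filter_union, Finset.card_union_of_disjoint (Finset.disjoint_filter_filter hd)]
      congr 2
      · refine Finset.filter_congr fun x hx => ?_
        simp [Finset.disjoint_left.1 hd hx]
      · refine Finset.filter_congr fun x hx => ?_
        simp [hx]
    rw [h1, Finset.card_union_of_disjoint hd]
    omega

theorem matchingLE_card (H : SimpleGraph V) (S : Finset V) : MatchingLE H S S.card :=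
  ⟨_, IsMatchingOn.id H S, by
    have : unmatched S id ≤ S.card := Finset.card_filter_le _ _
    omega⟩

theorem matchingLE_pair {x y : V} (h : H.Adj x y) : MatchingLE H {x, y} 1 := by
  obtain ⟨g, hg, he⟩ := (IsMatchingOn.id H {x, y}).add_edge (by simp) (by simp) h rfl rfl
  have h1 : unmatched {x, y} (id : V → V) ≤ _ := Finset.card_filter_le _ _
  rw [Finset.card_pair h.ne] at h1
  exact ⟨g, hg, by rw [Finset.card_pair h.ne]; omega⟩

theorem MatchingLE.cliqueCover {k : ℕ} (h : MatchingLE H S k) : CliqueCover H S k := by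
  obtain ⟨f, hf, hk⟩ := h
  induction hn : S.card using Nat.strong_induction_on generalizing S f k with
  | _ n ih =>
  rcases S.eq_empty_or_nonempty with rfl | ⟨x, hx⟩
  · exact cliqueCover_zero.mono subset_rfl (by omega)
  subst hn
  have hpos : 0 < S.card := Finset.card_pos.2 ⟨x, hx⟩
  obtain ⟨k, rfl⟩ : ∃ m, k = m + 1 := ⟨k - 1, by omega⟩
  by_cases hfx : f x = x
  · have h1 : IsMatchingOn H (S.erase x) f := ⟨hf.invol, hf.adj, fun y hy => by
      by_cases e : y = x
      · rw [e, hfx]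
      · exact hf.fix y fun h => hy (by simp [e, h])⟩
    have h2 : unmatched S f = unmatched (S.erase x) f + 1 := by
      unfold unmatched
      rw [Finset.filter_erase, Finset.card_erase_add_one (by simp [hx, hfx])]
    have h3 := Finset.card_erase_add_one hx
    have := ih (S.erase x).card (by omega) (k := k) f h1 (by omega) rfl
    refine CliqueCover.add_clique (Q := {x}) (by simp) ?_
    rwa [Finset.sdiff_singleton_eq_erase]
  · have hadj : H.Adj x (f x) := (hf.adj x).resolve_left hfx
    have hmem : f x ∈ S := hf.mem hx
    let Q : Finset V := {x, f x}
    have hQ : ∀ y, y ∈ Q → f y ∈ Q := by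
      intro y hy
      simp only [Q, Finset.mem_insert, Finset.mem_singleton] at hy ⊢
      rcases hy with rfl | rfl
      · exact Or.inr rfl
      · exact Or.inl (hf.invol x)
    have h1 : IsMatchingOn H (S \ Q) fun y => if y ∈ Q then y else f y := by
      have := (hf.piecewise (IsMatchingOn.id H S) (· ∈ Q) hQ fun _ h => h)
      refine ⟨this.invol, this.adj, fun y hy => ?_⟩
      by_cases e : y ∈ Q
      · simp [e]
      · simpa [e] using hf.fix y fun h => hy (by simp [e, h])
    have h2 : unmatched S f = unmatched (S \ Q) fun y => if y ∈ Q then y else f y := by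
      unfold unmatched
      congr 1
      ext y
      simp only [Finset.mem_filter, Finset.mem_sdiff]
      by_cases e : y ∈ Q
      · have : f y ≠ y := by
          simp only [Q, Finset.mem_insert, Finset.mem_singleton] at e
          rcases e with rfl | rfl
          · exact hfx
          · rw [hf.invol]; exact fun h => hfx h.symm
        simp [e, this]
      · simp [e]
    have h3 : (S \ Q).card + 2 = S.card := by
      have hs : Q ⊆ S := by simp [Q, Finset.insert_subset_iff, hx, hmem]
      have := Finset.card_sdiff_add_card_eq_card hs
      rwa [Finset.card_pair hadj.ne] at this
    have := ih (S \ Q).card (by omega) (k := k) _ h1 (by omega) rfl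
    exact CliqueCover.add_clique hadj.isClique_pair this

end Matchings

/-! ### Triangle-free sets: Ramsey bounds and the pentagon-free case -/

section TriangleFree

variable {V : Type*} [DecidableEq V] {H : SimpleGraph V} {S T : Finset V}

theorem TriangleFreeOn.isIndepSet_neighbors [DecidableRel H.Adj] (h : TriangleFreeOn H S) {v : V}
    (hv : v ∈ S) : H.IsIndepSet (S.filter (H.Adj v) : Set V) := by
  intro x hx y hy _ hxy
  simp only [Finset.coe_filter, Set.mem_ofPred_eq] at hx hy
  exact h hv hx.1 hy.1 hx.2 hy.2 hxy

theorem TriangleFreeOn.card_le_two_of_isClique (h : TriangleFreeOn H S)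
    (hc : H.IsClique (S : Set V)) : S.card ≤ 2 := by
  by_contra! hlt
  obtain ⟨x, y, z, hx, hy, hz, hxy, hxz, hyz⟩ := Finset.two_lt_card_iff.1 hlt
  exact h hx hy hz (hc hx hy hxy) (hc hx hz hxz) (hc hy hz hyz)

theorem isClique_nonneighbors [DecidableRel H.Adj] (h : IndepLE H S 2) {v : V} (hv : v ∈ S) :
    H.IsClique (S.filter fun x => x ≠ v ∧ ¬ H.Adj v x : Set V) := by
  intro x hx y hy hne
  simp only [Finset.coe_filter, Set.mem_ofPred_eq] at hx hy
  rcases h.adj_of_two hv hx.1 hy.1 hx.2.1.symm hy.2.1.symm hne with h | h | h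
  · exact absurd h hx.2.2
  · exact absurd h hy.2.2
  · exact h

theorem card_eq_neighbors_add [DecidableRel H.Adj] {v : V} (hv : v ∈ S) :
    S.card = 1 + (S.filter (H.Adj v)).card + (S.filter fun x => x ≠ v ∧ ¬ H.Adj v x).card := by
  have h1 : S = insert v (S.filter (H.Adj v) ∪ S.filter fun x => x ≠ v ∧ ¬ H.Adj v x) := by
    ext x
    simp only [Finset.mem_insert, Finset.mem_union, Finset.mem_filter]
    by_cases e : x = v
    · simp [e, hv]
    · by_cases ha : H.Adj v x <;> simp [e, ha]
  conv_lhs => rw [h1]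
  rw [Finset.card_insert_of_notMem (by simp), Finset.card_union_of_disjoint]
  · omega
  · refine Finset.disjoint_left.2 fun x hx hy => ?_
    simp only [Finset.mem_filter] at hx hy
    exact hy.2.2 hx.2

/-- The Ramsey bound `R(3,3) ≤ 6`. -/
theorem TriangleFreeOn.card_le_five (h : TriangleFreeOn H S) (h2 : IndepLE H S 2) :
    S.card ≤ 5 := by
  classical
  rcases S.eq_empty_or_nonempty with rfl | ⟨v, hv⟩
  · simp
  have h3 := h2 _ (Finset.filter_subset _ _) (h.isIndepSet_neighbors hv)
  have h4 := (h.mono (Finset.filter_subset _ _)).card_le_two_of_isClique (isClique_nonneighbors h2 hv)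
  have := card_eq_neighbors_add (H := H) hv
  omega

/-- A closed walk of length five; in a triangle-free set this is an induced pentagon. -/
structure IsPentagon (H : SimpleGraph V) (S : Finset V) (c : Fin 5 → V) : Prop where
  mem : ∀ i, c i ∈ S
  adj : ∀ i, H.Adj (c i) (c (i + 1))

theorem isPentagon_mk {x y z w t : V} (hx : x ∈ S) (hy : y ∈ S) (hz : z ∈ S) (hw : w ∈ S)
    (ht : t ∈ S) (h1 : H.Adj x y) (h2 : H.Adj y z) (h3 : H.Adj z w) (h4 : H.Adj w t)
    (h5 : H.Adj t x) : ∃ c, IsPentagon H S c :=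
  ⟨![x, y, z, w, t], fun i => by fin_cases i <;> assumption, fun i => by
    fin_cases i <;> assumption⟩

/-- This is the equality case of the Ramsey count: neighbours and non-neighbours of a vertex each
number at most two, so every degree is exactly two. -/
theorem exists_isPentagon (h : TriangleFreeOn H S) (h2 : IndepLE H S 2) (h5 : 5 ≤ S.card) :
    ∃ c, IsPentagon H S c := by
  classical
  have hdeg : ∀ v ∈ S, (S.filter (H.Adj v)).card = 2 := by
    intro v hv
    have h3 := h2 _ (Finset.filter_subset _ _) (h.isIndepSet_neighbors hv)
    have h4 := (h.mono (Finset.filter_subset _ _)).card_le_two_of_isClique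
      (isClique_nonneighbors h2 hv)
    have := card_eq_neighbors_add (H := H) hv
    omega
  obtain ⟨v, hv⟩ : S.Nonempty := Finset.card_pos.1 (by omega)
  have hother : ∀ x ∈ S, ∀ y ∈ S, H.Adj x y → ∃ z ∈ S, z ≠ y ∧ H.Adj x z := by
    intro x hx y hy hxy
    obtain ⟨z, hz, hzy⟩ := Finset.exists_mem_ne (by rw [hdeg x hx]; omega : 1 < (S.filter (H.Adj x)).card) y
    simp only [Finset.mem_filter] at hz
    exact ⟨z, hz.1, hzy, hz.2⟩
  have hnon : ∀ x ∈ S, ∀ y ∈ S, ∀ z ∈ S, ∀ w ∈ S, H.Adj x y → H.Adj x z → H.Adj x w →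
      w = y ∨ w = z ∨ y = z := by
    intro x hx y hy z hz w hw hy' hz' hw'
    by_contra! hc
    have := Finset.two_lt_card_iff.2 ⟨w, y, z, Finset.mem_filter.2 ⟨hw, hw'⟩,
      Finset.mem_filter.2 ⟨hy, hy'⟩, Finset.mem_filter.2 ⟨hz, hz'⟩, hc.1, hc.2.1, hc.2.2⟩
    rw [hdeg x hx] at this
    omega
  obtain ⟨a, ha⟩ : (S.filter (H.Adj v)).Nonempty := Finset.card_pos.1 (by rw [hdeg v hv]; omega)
  simp only [Finset.mem_filter] at ha
  obtain ⟨b, hb, hba, hvb⟩ := hother v hv a ha.1 ha.2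
  obtain ⟨x, hx, hxv, hax⟩ := hother a ha.1 v hv ha.2.symm
  obtain ⟨y, hy, hyv, hby⟩ := hother b hb v hv hvb.symm
  have hab : ¬ H.Adj a b := fun e => h hv ha.1 hb ha.2 hvb e
  have hvx : ¬ H.Adj v x := fun e => h hv ha.1 hx ha.2 e hax
  have hvy : ¬ H.Adj v y := fun e => h hv hb hy hvb e hby
  by_cases hxy : x = y
  -- Here `v, a, x, b` is a 4-cycle that already uses both neighbours of `a` and of `b`, so a fifth
  -- vertex forms an independent triple with `a` and `b`.
  · subst hxy
    obtain ⟨d, hd, hdn⟩ := Finset.exists_mem_notMem_of_card_lt_card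
      (show ({v, a, b, x} : Finset V).card < S.card from
        (Finset.card_le_four).trans_lt (by omega))
    simp only [Finset.mem_insert, Finset.mem_singleton, not_or] at hdn
    rcases h2.adj_of_two ha.1 hb hd hba.symm (Ne.symm hdn.2.1) (Ne.symm hdn.2.2.1) with e | e | e
    · exact absurd e hab
    · rcases hnon a ha.1 v hv x hx d hd ha.2.symm hax e with e | e | e
      · exact absurd e hdn.1
      · exact absurd e hdn.2.2.2
      · exact absurd e.symm hxv
    · rcases hnon b hb v hv x hx d hd hvb.symm hby e with e | e | e
      · exact absurd e hdn.1
      · exact absurd e hdn.2.2.2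
      · exact absurd e.symm hxv
  · rcases h2.adj_of_two hv hx hy hxv.symm hyv.symm hxy with e | e | e
    · exact absurd e hvx
    · exact absurd e hvy
    · exact isPentagon_mk hv ha.1 hx hy hb ha.2 hax e hby.symm hvb.symm

/-- If no vertex outside an edge `uv` is joined to both neighbourhoods, the bound is immediate. -/
theorem card_le_or_isPentagon (h : TriangleFreeOn H S) (hP : NoEdgeWithTriple H) {a : ℕ}
    (ha : IndepLE H S a) : S.card ≤ 2 * a + 2 ∨ ∃ c, IsPentagon H S c := by
  classical
  by_cases he : ∀ x ∈ S, ∀ y ∈ S, ¬ H.Adj x y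
  · have := ha S subset_rfl fun x hx y hy _ => he x hx y hy
    omega
  push Not at he
  obtain ⟨u, hu, v, hv, huv⟩ := he
  by_contra! hc
  obtain ⟨hcard, hnp⟩ := hc
  set P := S.filter (H.Adj u) with hPdef
  set R := S.filter (H.Adj v) with hRdef
  set W := S.filter fun x => ¬ H.Adj u x ∧ ¬ H.Adj v x with hWdef
  have hPi := h.isIndepSet_neighbors hu
  have hRi := h.isIndepSet_neighbors hv
  have hPa := ha _ (Finset.filter_subset _ _) hPi
  have hRa := ha _ (Finset.filter_subset _ _) hRi
  have hWS : W ⊆ S := Finset.filter_subset _ _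
  have hsum : S.card ≤ P.card + R.card + W.card := by
    have : S ⊆ P ∪ R ∪ W := by
      intro x hx
      simp only [hPdef, hRdef, hWdef, Finset.mem_union, Finset.mem_filter, hx, true_and]
      tauto
    exact (Finset.card_le_card this).trans ((Finset.card_union_le _ _).trans
      (Nat.add_le_add_right (Finset.card_union_le _ _) _))
  have hW2 : IndepLE H W 2 := indepLE_two fun x hx y hy z hz hxy hxz hyz h1 h2 h3 => by
    simp only [hWdef, Finset.mem_filter] at hx hy hz
    exact hP huv hxy hxz hyz h1 h2 h3 hx.2.1 hy.2.1 hz.2.1 hx.2.2 hy.2.2 hz.2.2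
  have hW4 : W.card ≤ 4 := by
    by_contra! h5
    obtain ⟨c, hc⟩ := exists_isPentagon (h.mono hWS) hW2 h5
    exact hnp c ⟨fun i => hWS (hc.mem i), hc.adj⟩
  -- Otherwise `u, v, r, w, p` is a pentagon.
  have hside : ∀ w ∈ W, (∀ p ∈ P, ¬ H.Adj w p) ∨ (∀ r ∈ R, ¬ H.Adj w r) := by
    intro w hw
    by_contra! hc
    obtain ⟨⟨p, hp, hwp⟩, ⟨r, hr, hwr⟩⟩ := hc
    simp only [hPdef, hRdef, Finset.mem_filter] at hp hr
    obtain ⟨c, hc⟩ := isPentagon_mk hu hv hr.1 (hWS hw) hp.1 huv hr.2 hwr.symm hwp hp.2.symm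
    exact hnp c hc
  have hext : ∀ (v : V) (I : Finset V), I ⊆ W → H.IsIndepSet (I : Set V) →
      H.IsIndepSet (S.filter (H.Adj v) : Set V) →
      (∀ w ∈ I, ¬ H.Adj v w) → (∀ w ∈ I, ∀ p ∈ S.filter (H.Adj v), ¬ H.Adj w p) →
      (S.filter (H.Adj v)).card + I.card ≤ a := by
    intro v I hI hIi hN h1 h2
    have := ha (S.filter (H.Adj v) ∪ I) (Finset.union_subset (Finset.filter_subset _ _) (hI.trans hWS)) (by
      intro x hx y hy hne
      simp only [Finset.coe_union, Set.mem_union, Finset.mem_coe] at hx hy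
      rcases hx with hx | hx <;> rcases hy with hy | hy
      · exact hN (by simpa using hx) (by simpa using hy) hne
      · exact fun e => h2 y hy x hx e.symm
      · exact h2 x hx y hy
      · exact hIi (by simpa using hx) (by simpa using hy) hne)
    rwa [Finset.card_union_of_disjoint] at this
    refine Finset.disjoint_left.2 fun x hx hx' => h1 x hx' (Finset.mem_filter.1 hx).2
  rw [hPdef, hRdef] at hsum
  have hPu := hext u
  have hRv := hext v
  have hsing : ∀ w : V, H.IsIndepSet (({w} : Finset V) : Set V) := fun w => by simp
  have hWu : ∀ w ∈ W, ¬ H.Adj u w := fun w hw => (Finset.mem_filter.1 hw).2.1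
  have hWv : ∀ w ∈ W, ¬ H.Adj v w := fun w hw => (Finset.mem_filter.1 hw).2.2
  -- Since |P| + |R| ≤ 2a < |S| - 2, the set `W` has at least three vertices, too many for a clique.
  obtain ⟨w, hw, z, hz, hwz, hna⟩ : ∃ w ∈ W, ∃ z ∈ W, w ≠ z ∧ ¬ H.Adj w z := by
    by_contra! hcl
    have := (h.mono hWS).card_le_two_of_isClique fun x hx y hy hne => hcl x hx y hy hne
    omega
  have hpair : H.IsIndepSet (({w, z} : Finset V) : Set V) := by
    intro x hx y hy hne
    simp only [Finset.coe_insert, Finset.coe_singleton, Set.mem_insert_iff,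
      Set.mem_singleton_iff] at hx hy
    rcases hx with rfl | rfl <;> rcases hy with rfl | rfl
    · exact absurd rfl hne
    · exact hna
    · exact fun e => hna e.symm
    · exact absurd rfl hne
  have hsub : ({w, z} : Finset V) ⊆ W := by simp [Finset.insert_subset_iff, hw, hz]
  have hc2 := Finset.card_pair hwz
  -- Adjoining `w` and `z` to the neighbourhoods that they miss lowers the bound on |P| + |R| from
  -- 2a to 2a - 2; with |W| ≤ 4 this gives |S| ≤ 2a + 2.
  rcases hside w hw with h1 | h1 <;> rcases hside z hz with h2 | h2
  · have := hPu {w, z} hsub hpair hPi (by simpa using ⟨hWu w hw, hWu z hz⟩)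
      (by intro x hx; simp only [Finset.mem_insert, Finset.mem_singleton] at hx
          rcases hx with rfl | rfl <;> assumption)
    omega
  · have e1 := hPu {w} (by simpa using hw) (hsing w) hPi (by simpa using hWu w hw)
      (by intro x hx; rw [Finset.mem_singleton.1 hx]; exact h1)
    have e2 := hRv {z} (by simpa using hz) (hsing z) hRi (by simpa using hWv z hz)
      (by intro x hx; rw [Finset.mem_singleton.1 hx]; exact h2)
    simp only [Finset.card_singleton] at e1 e2
    omega
  · have e1 := hPu {z} (by simpa using hz) (hsing z) hPi (by simpa using hWu z hz)
      (by intro x hx; rw [Finset.mem_singleton.1 hx]; exact h2)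
    have e2 := hRv {w} (by simpa using hw) (hsing w) hRi (by simpa using hWv w hw)
      (by intro x hx; rw [Finset.mem_singleton.1 hx]; exact h1)
    simp only [Finset.card_singleton] at e1 e2
    omega
  · have := hRv {w, z} hsub hpair hRi (by simpa using ⟨hWv w hw, hWv z hz⟩)
      (by intro x hx; simp only [Finset.mem_insert, Finset.mem_singleton] at hx
          rcases hx with rfl | rfl <;> assumption)
    omega

end TriangleFree

/-! ### Vertices classified by their neighbours on a pentagon -/

section Pentagons

variable {V : Type*} [DecidableEq V] {H : SimpleGraph V} {S T : Finset V} {c : Fin 5 → V}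

/-- `x` is adjacent to both neighbours of `c i` on the pentagon `c`. -/
def IsTwin (H : SimpleGraph V) (c : Fin 5 → V) (i : Fin 5) (x : V) : Prop :=
  x ≠ c i ∧ H.Adj (c (i + 4)) x ∧ H.Adj (c (i + 1)) x

/-- The only neighbour of `x` on the pentagon `c` is `c i`. -/
def IsPendant (H : SimpleGraph V) (c : Fin 5 → V) (i : Fin 5) (x : V) : Prop :=
  H.Adj (c i) x ∧ ∀ j, j ≠ i → ¬ H.Adj (c j) x

/-- No vertex of the pentagon `c` is adjacent to `x`. -/
def IsFar (H : SimpleGraph V) (c : Fin 5 → V) (x : V) : Prop :=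
  ∀ j, ¬ H.Adj (c j) x

theorem fin_five_add : ∀ i : Fin 5, i + 1 + 1 = i + 2 ∧ i + 1 + 4 = i ∧ i + 4 + 1 = i := by
  decide

/-- An independent subset of the 5-cycle is two vertices at distance two, a single vertex, or empty.
Indices are cyclic, so `i + 4` means i - 1. -/
theorem pentagon_pattern : ∀ f : Fin 5 → Bool, (∀ i, f i = true → f (i + 1) = false) →
    (∃ i, f (i + 4) = true ∧ f (i + 1) = true) ∨
    (∃ i, f i = true ∧ ∀ j, j ≠ i → f j = false) ∨ ∀ j, f j = false := by
  decide

/-- `s` and `p` record the positions carrying a twin or a pendant vertex. The bound 5 comes from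
pairing `p i` with `s (i + 1)`. The other two clauses list configurations that produce four
independent vertices, or contradict the presence of a far vertex. -/
theorem extras_pattern : ∀ s p : Fin 5 → Bool,
    (∀ i, p i = true → s (i + 1) = false ∧ s (i + 4) = false) →
    ∑ i, ((s i).toNat + (p i).toNat) ≤ 5 ∧
    (4 ≤ ∑ i, ((s i).toNat + (p i).toNat) → ∃ i, (s i = true ∧ s (i + 2) = true) ∨
      (p i = true ∧ p (i + 1) = true ∧ p (i + 3) = true)) ∧
    (3 ≤ ∑ i, ((s i).toNat + (p i).toNat) → ∃ i, (s i = true ∧ s (i + 2) = true) ∨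
      (s i = true ∧ p (i + 3) = true) ∨ (s i = true ∧ p (i + 2) = true) ∨
      (p i = true ∧ p (i + 2) = true)) := by
  decide +kernel

namespace IsPentagon

theorem not_adj (hc : IsPentagon H S c) (h : TriangleFreeOn H S) (i : Fin 5) :
    ¬ H.Adj (c i) (c (i + 2)) := fun e =>
  h (hc.mem i) (hc.mem (i + 1)) (hc.mem (i + 2)) (hc.adj i) e
    ((fin_five_add i).1 ▸ hc.adj (i + 1))

theorem adj_iff (hc : IsPentagon H S c) (h : TriangleFreeOn H S) (i j : Fin 5) :
    H.Adj (c i) (c j) ↔ j = i + 1 ∨ j = i + 4 := by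
  have key : ∀ i j : Fin 5, j = i ∨ j = i + 1 ∨ j = i + 2 ∨ i = j + 2 ∨ i = j + 1 := by decide
  constructor
  · intro e
    rcases key i j with rfl | rfl | rfl | rfl | rfl
    · exact absurd e H.irrefl
    · exact Or.inl rfl
    · exact absurd e (hc.not_adj h _)
    · exact absurd e.symm (hc.not_adj h _)
    · exact Or.inr (fin_five_add j).2.1.symm
  · rintro (rfl | rfl)
    · exact hc.adj i
    · have := hc.adj (i + 4)
      rw [(fin_five_add i).2.2] at this
      exact this.symm

/-- Distinct vertices of a 5-cycle have distinct neighbourhoods. -/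
theorem ne (hc : IsPentagon H S c) (h : TriangleFreeOn H S) {i j : Fin 5} (hij : i ≠ j) :
    c i ≠ c j := by
  intro e
  have h1 : ∀ k, (i = k + 1 ∨ i = k + 4) ↔ (j = k + 1 ∨ j = k + 4) := fun k => by
    rw [← hc.adj_iff h, ← hc.adj_iff h, e]
  revert h1 hij
  clear e
  decide +revert

/-- Two vertices missing `c m` and the edge opposite to it are adjacent. -/
theorem adj_of_miss (hc : IsPentagon H S c) (h : TriangleFreeOn H S) (hP : NoEdgeWithTriple H)
    (m : Fin 5) {x y : V} (hxy : x ≠ y) (hxm : x ≠ c m) (hym : y ≠ c m)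
    (hx : ¬ H.Adj (c m) x) (hx2 : ¬ H.Adj (c (m + 2)) x) (hx3 : ¬ H.Adj (c (m + 3)) x)
    (hy : ¬ H.Adj (c m) y) (hy2 : ¬ H.Adj (c (m + 2)) y) (hy3 : ¬ H.Adj (c (m + 3)) y) :
    H.Adj x y := by
  by_contra hn
  refine hP (x := c m) (y := x) (z := y) (u := c (m + 2)) (v := c (m + 3)) ?_ hxm.symm hym.symm hxy
    hx hy hn ?_ hx2 hy2 ?_ hx3 hy3
  all_goals
    rw [hc.adj_iff h]
    clear hx hx2 hx3 hy hy2 hy3 hxm hym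
    decide +revert

theorem twin_not_adj (hc : IsPentagon H S c) (h : TriangleFreeOn H S) {i : Fin 5} {x : V}
    (hx : x ∈ S) (ht : IsTwin H c i x) : ¬ H.Adj (c i) x ∧ ¬ H.Adj (c (i + 2)) x ∧
      ¬ H.Adj (c (i + 3)) x := by
  have key : ∀ j k, H.Adj (c k) x → (k = j + 1 ∨ k = j + 4) → ¬ H.Adj (c j) x := fun j k hk hjk e =>
    h (hc.mem j) (hc.mem k) hx ((hc.adj_iff h j k).2 hjk) e hk
  refine ⟨key i (i + 1) ht.2.2 (Or.inl rfl), key _ (i + 1) ht.2.2 ?_, key _ (i + 4) ht.2.1 ?_⟩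
  all_goals
    clear ht key
    decide +revert

theorem twin_ne (hc : IsPentagon H S c) (h : TriangleFreeOn H S) {i : Fin 5} {x : V}
    (hx : x ∈ S) (ht : IsTwin H c i x) (j : Fin 5) : x ≠ c j := by
  have key : ∀ i j : Fin 5, j = i ∨ j = i + 1 ∨ j = i + 2 ∨ j = i + 3 ∨ j = i + 4 := by decide
  rintro rfl
  obtain ⟨h1, h2, h3⟩ := hc.twin_not_adj h hx ht
  rcases key i j with rfl | rfl | rfl | rfl | rfl
  · exact ht.1 rfl
  · exact H.irrefl ht.2.2
  · exact h3 ((hc.adj_iff h _ _).2 (by clear ht hx h1 h2 h3 key; decide +revert))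
  · exact h2 (hc.adj_iff h _ _ |>.2 (by clear ht hx h1 h2 h3 key; decide +revert))
  · exact H.irrefl ht.2.1

theorem pendant_ne (hc : IsPentagon H S c) (h : TriangleFreeOn H S) {i : Fin 5} {x : V}
    (ht : IsPendant H c i x) (j : Fin 5) : x ≠ c j := by
  rintro rfl
  have h1 := ht.2 (j + 1)
  have h2 := ht.2 (j + 4)
  rw [hc.adj_iff h] at h1 h2
  clear ht
  revert h1 h2
  decide +revert

theorem far_ne (hc : IsPentagon H S c) (h : TriangleFreeOn H S) {x : V}
    (ht : IsFar H c x) (j : Fin 5) : x ≠ c j := by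
  rintro rfl
  exact ht (j + 4) ((hc.adj_iff h _ _).2 (by clear ht; decide +revert))

theorem trichotomy (hc : IsPentagon H S c) (h : TriangleFreeOn H S) {x : V} (hx : x ∈ S) :
    (∃ i, x = c i) ∨ (∃ i, IsTwin H c i x) ∨ (∃ i, IsPendant H c i x) ∨ IsFar H c x := by
  classical
  rcases pentagon_pattern (fun i => decide (H.Adj (c i) x)) (fun i hi => by
    simp only [decide_eq_true_eq, decide_eq_false_iff_not] at hi ⊢
    exact fun e => h (hc.mem i) (hc.mem (i + 1)) hx (hc.adj i) hi e) with ⟨i, h1, h2⟩ | ⟨i, h1, h2⟩ | h1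
  · simp only [decide_eq_true_eq] at h1 h2
    by_cases e : x = c i
    · exact Or.inl ⟨i, e⟩
    · exact Or.inr (Or.inl ⟨i, e, h1, h2⟩)
  · simp only [decide_eq_true_eq, decide_eq_false_iff_not] at h1 h2
    exact Or.inr (Or.inr (Or.inl ⟨i, h1, h2⟩))
  · simp only [decide_eq_false_iff_not] at h1
    exact Or.inr (Or.inr (Or.inr h1))

/-- Two twins at the same position would be adjacent by `adj_of_miss` and would form a triangle with
`c (i + 1)`. -/
theorem twin_unique (hc : IsPentagon H S c) (h : TriangleFreeOn H S) (hP : NoEdgeWithTriple H)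
    {i : Fin 5} {x y : V} (hx : x ∈ S) (hy : y ∈ S) (htx : IsTwin H c i x) (hty : IsTwin H c i y) :
    x = y := by
  by_contra hne
  obtain ⟨h1, h2, h3⟩ := hc.twin_not_adj h hx htx
  obtain ⟨h4, h5, h6⟩ := hc.twin_not_adj h hy hty
  exact h (hc.mem (i + 1)) hx hy htx.2.2 hty.2.2
    (hc.adj_of_miss h hP i hne htx.1 hty.1 h1 h2 h3 h4 h5 h6)

theorem pendant_unique (hc : IsPentagon H S c) (h : TriangleFreeOn H S) (hP : NoEdgeWithTriple H)
    {i : Fin 5} {x y : V} (hx : x ∈ S) (hy : y ∈ S) (htx : IsPendant H c i x)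
    (hty : IsPendant H c i y) : x = y := by
  by_contra hne
  refine h (hc.mem i) hx hy htx.1 hty.1 (hc.adj_of_miss h hP (i + 1) hne (hc.pendant_ne h htx _)
    (hc.pendant_ne h hty _) (htx.2 _ ?_) (htx.2 _ ?_) (htx.2 _ ?_) (hty.2 _ ?_) (hty.2 _ ?_)
    (hty.2 _ ?_))
  all_goals
    clear htx hty
    decide +revert

/-- Both vertices see `c i` and miss `c (i + 1)` and its opposite edge, so they would be adjacent
and close a triangle. -/
theorem pendant_not_twin_succ (hc : IsPentagon H S c) (h : TriangleFreeOn H S)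
    (hP : NoEdgeWithTriple H) {i : Fin 5} {x y : V} (hx : x ∈ S) (hy : y ∈ S)
    (htx : IsPendant H c i x) (hty : IsTwin H c (i + 1) y) : False := by
  have hiy : H.Adj (c i) y := by
    have := hty.2.1
    rwa [(fin_five_add i).2.1] at this
  obtain ⟨h4, h5, h6⟩ := hc.twin_not_adj h hy hty
  have hne : x ≠ y := by
    rintro rfl
    exact htx.2 (i + 1 + 1) (by clear hiy h4 h5 h6 htx hty; decide +revert) hty.2.2
  refine h (hc.mem i) hx hy htx.1 hiy (hc.adj_of_miss h hP (i + 1) hne (hc.pendant_ne h htx _) hty.1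
    (htx.2 _ ?_) (htx.2 _ ?_) (htx.2 _ ?_) h4 h5 h6)
  all_goals
    clear hiy h4 h5 h6 htx hty
    decide +revert

theorem pendant_not_twin_pred (hc : IsPentagon H S c) (h : TriangleFreeOn H S)
    (hP : NoEdgeWithTriple H) {i : Fin 5} {x y : V} (hx : x ∈ S) (hy : y ∈ S)
    (htx : IsPendant H c i x) (hty : IsTwin H c (i + 4) y) : False := by
  have hiy : H.Adj (c i) y := by
    have := hty.2.2
    rwa [(fin_five_add i).2.2] at this
  obtain ⟨h4, h5, h6⟩ := hc.twin_not_adj h hy hty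
  have hne : x ≠ y := by
    rintro rfl
    exact htx.2 (i + 4 + 4) (by clear hiy h4 h5 h6 htx hty; decide +revert) hty.2.1
  refine h (hc.mem i) hx hy htx.1 hiy (hc.adj_of_miss h hP (i + 4) hne (hc.pendant_ne h htx _) hty.1
    (htx.2 _ ?_) (htx.2 _ ?_) (htx.2 _ ?_) h4 h5 h6)
  all_goals
    clear hiy h4 h5 h6 htx hty
    decide +revert

theorem pendant_adj_pendant (hc : IsPentagon H S c) (h : TriangleFreeOn H S)
    (hP : NoEdgeWithTriple H) {i : Fin 5} {x y : V} (htx : IsPendant H c i x)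
    (hty : IsPendant H c (i + 2) y) : H.Adj x y := by
  have hne : x ≠ y := by
    rintro rfl
    exact htx.2 (i + 2) (by clear htx hty; decide +revert) hty.1
  refine hc.adj_of_miss h hP (i + 1) hne (hc.pendant_ne h htx _) (hc.pendant_ne h hty _)
    (htx.2 _ ?_) (htx.2 _ ?_) (htx.2 _ ?_) (hty.2 _ ?_) (hty.2 _ ?_) (hty.2 _ ?_)
  all_goals
    clear htx hty
    decide +revert

theorem far_adj_far (hc : IsPentagon H S c) (h : TriangleFreeOn H S) (hP : NoEdgeWithTriple H)
    {x y : V} (hxy : x ≠ y) (hx : IsFar H c x) (hy : IsFar H c y) : H.Adj x y :=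
  hc.adj_of_miss h hP 0 hxy (hc.far_ne h hx _) (hc.far_ne h hy _) (hx _) (hx _) (hx _) (hy _) (hy _)
    (hy _)

theorem far_adj_pendant (hc : IsPentagon H S c) (h : TriangleFreeOn H S) (hP : NoEdgeWithTriple H)
    {i : Fin 5} {x y : V} (hx : IsFar H c x) (hy : IsPendant H c i y) : H.Adj x y := by
  have hne : x ≠ y := by rintro rfl; exact hx _ hy.1
  refine hc.adj_of_miss h hP (i + 1) hne (hc.far_ne h hx _) (hc.pendant_ne h hy _) (hx _) (hx _)
    (hx _) (hy.2 _ ?_) (hy.2 _ ?_) (hy.2 _ ?_)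
  all_goals
    clear hx hy
    decide +revert

theorem far_adj_twin (hc : IsPentagon H S c) (h : TriangleFreeOn H S) (hP : NoEdgeWithTriple H)
    {i : Fin 5} {x y : V} (hyS : y ∈ S) (hx : IsFar H c x) (hy : IsTwin H c i y) : H.Adj x y := by
  have hne : x ≠ y := by rintro rfl; exact hx _ hy.2.1
  obtain ⟨h4, h5, h6⟩ := hc.twin_not_adj h hyS hy
  exact hc.adj_of_miss h hP i hne (hc.far_ne h hx _) hy.1 (hx _) (hx _) (hx _) h4 h5 h6

end IsPentagon

end Pentagons

/-! ### The bound 2a + 2 and matchings of triangle-free sets -/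

section TriangleFreeBound

variable {V : Type*} [DecidableEq V] {H : SimpleGraph V} {S T : Finset V} {c : Fin 5 → V}

namespace IsPentagon

/-- The vertices `x`, `y`, `c i`, `c (i + 2)` are all neighbours of `c (i + 1)`, hence independent.
-/
theorem four_le_of_twins (hc : IsPentagon H S c) (h : TriangleFreeOn H S) {a : ℕ}
    (ha : IndepLE H S a) {i : Fin 5} {x y : V} (hx : x ∈ S) (hy : y ∈ S) (htx : IsTwin H c i x)
    (hty : IsTwin H c (i + 2) y) : 4 ≤ a := by
  have h1 : H.Adj (c (i + 1)) (c i) := (hc.adj i).symm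
  have h2 : H.Adj (c (i + 1)) (c (i + 2)) := (fin_five_add i).1 ▸ hc.adj (i + 1)
  have h3 : H.Adj (c (i + 1)) y := by
    have := hty.2.1
    rwa [show i + 2 + 4 = i + 1 by clear h1 h2 this hty htx; decide +revert] at this
  have key : ∀ {v w}, v ∈ S → w ∈ S → H.Adj (c (i + 1)) v → H.Adj (c (i + 1)) w → ¬ H.Adj v w :=
    fun hv hw h1 h2 e => h (hc.mem (i + 1)) hv hw h1 h2 e
  have hne : x ≠ y := by
    rintro rfl
    exact (hc.twin_not_adj h hx htx).2.2 (by
      have := hty.2.2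
      rwa [show i + 2 + 1 = i + 3 by clear key h1 h2 h3 this hty htx; decide +revert] at this)
  exact ha.four_le hx hy (hc.mem i) (hc.mem (i + 2)) hne (hc.twin_ne h hx htx _)
    (hc.twin_ne h hx htx _) (hc.twin_ne h hy hty _) (hc.twin_ne h hy hty _)
    (hc.ne h (by clear key h1 h2 h3 htx hty; decide +revert)) (key hx hy htx.2.2 h3)
    (key hx (hc.mem _) htx.2.2 h1) (key hx (hc.mem _) htx.2.2 h2) (key hy (hc.mem _) h3 h1)
    (key hy (hc.mem _) h3 h2) (hc.not_adj h i)

theorem pendant_ne_pendant {i j : Fin 5} {x y : V} (hij : i ≠ j) (hx : IsPendant H c i x)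
    (hy : IsPendant H c j y) : x ≠ y := by
  rintro rfl
  exact hx.2 j hij.symm hy.1

/-- Pendants two positions apart are adjacent, so `z` sees both `x` and `y`, which are therefore
nonadjacent. They join `c (i + 2)` and `c (i + 4)` in an independent set. -/
theorem four_le_of_pendants (hc : IsPentagon H S c) (h : TriangleFreeOn H S)
    (hP : NoEdgeWithTriple H) {a : ℕ} (ha : IndepLE H S a) {i : Fin 5} {x y z : V} (hx : x ∈ S)
    (hy : y ∈ S) (hz : z ∈ S) (htx : IsPendant H c i x) (hty : IsPendant H c (i + 1) y)
    (htz : IsPendant H c (i + 3) z) : 4 ≤ a := by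
  have hzx : H.Adj z x := hc.pendant_adj_pendant h hP htz (by
    rwa [show i + 3 + 2 = i by clear htx hty htz; decide +revert])
  have hyz : H.Adj y z := hc.pendant_adj_pendant h hP hty (by
    rwa [show i + 1 + 2 = i + 3 by clear htx hty htz hzx; decide +revert])
  have hxy : ¬ H.Adj x y := fun e => h hx hy hz e hzx.symm hyz
  have hne : x ≠ y := pendant_ne_pendant (by clear htx hty htz; decide +revert) htx hty
  refine ha.four_le hx hy (hc.mem (i + 4)) (hc.mem (i + 2)) hne (hc.pendant_ne h htx _)
    (hc.pendant_ne h htx _) (hc.pendant_ne h hty _) (hc.pendant_ne h hty _)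
    (hc.ne h (by clear htx hty htz; decide +revert)) hxy (fun e => htx.2 _ ?_ e.symm)
    (fun e => htx.2 _ ?_ e.symm) (fun e => hty.2 _ ?_ e.symm) (fun e => hty.2 _ ?_ e.symm) ?_
  · clear htx hty htz e; decide +revert
  · clear htx hty htz e; decide +revert
  · clear htx hty htz e; decide +revert
  · clear htx hty htz e; decide +revert
  · rw [hc.adj_iff h]
    clear htx hty htz; decide +revert

/-- The independent set is `x`, `y`, `c i`, `c k`: of the two vertices opposite `c i`, `c j` is the
one attached to `y` and `c k` is the other. -/
theorem four_le_of_twin_pendant (hc : IsPentagon H S c) (h : TriangleFreeOn H S) {a : ℕ}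
    (ha : IndepLE H S a) {i j k : Fin 5} {x y : V} (hx : x ∈ S) (hy : y ∈ S)
    (htx : IsTwin H c i x) (hty : IsPendant H c j y) (hxy : ¬ H.Adj x y)
    (hjk : (j = i + 3 ∧ k = i + 2) ∨ (j = i + 2 ∧ k = i + 3)) : 4 ≤ a := by
  have hne : x ≠ y := by
    rintro rfl
    refine hty.2 (i + 1) ?_ htx.2.2
    clear htx hty
    decide +revert
  obtain ⟨h1, h2, h3⟩ := hc.twin_not_adj h hx htx
  have hxk : ¬ H.Adj (c k) x := by
    rcases hjk with ⟨-, rfl⟩ | ⟨-, rfl⟩ <;> assumption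
  refine ha.four_le hx hy (hc.mem i) (hc.mem k) hne (hc.twin_ne h hx htx _)
    (hc.twin_ne h hx htx _) (hc.pendant_ne h hty _) (hc.pendant_ne h hty _)
    (hc.ne h ?_) hxy (fun e => h1 e.symm) (fun e => hxk e.symm) (fun e => hty.2 _ ?_ e.symm)
    (fun e => hty.2 _ ?_ e.symm) ?_
  · clear htx hty h1 h2 h3 hxk; decide +revert
  · clear htx hty h1 h2 h3 hxk e; decide +revert
  · clear htx hty h1 h2 h3 hxk e; decide +revert
  · rw [hc.adj_iff h]
    clear htx hty h1 h2 h3 hxk; decide +revert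

/-- Count the five pentagon vertices, the far vertices `Z`, and the twins and pendants `E`. Each
enlargement of `Z` or `E` forces a larger independent set. -/
theorem card_le (hc : IsPentagon H S c) (h : TriangleFreeOn H S) (hP : NoEdgeWithTriple H) {a : ℕ}
    (ha : IndepLE H S a) : S.card ≤ 2 * a + 2 := by
  classical
  set Z := S.filter (IsFar H c) with hZ
  set E := S.filter fun x => ∃ i, IsTwin H c i x ∨ IsPendant H c i x with hE
  set s : Fin 5 → Bool := fun i => decide (∃ x ∈ S, IsTwin H c i x) with hs
  set p : Fin 5 → Bool := fun i => decide (∃ x ∈ S, IsPendant H c i x) with hp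
  have hcard : S.card ≤ 5 + Z.card + E.card := by
    have hsub : S ⊆ Finset.univ.image c ∪ Z ∪ E := by
      intro x hx
      simp only [hZ, hE, Finset.mem_union, Finset.mem_image, Finset.mem_univ, true_and,
        Finset.mem_filter, hx]
      rcases hc.trichotomy h hx with ⟨i, hi⟩ | ⟨i, hi⟩ | ⟨i, hi⟩ | hi
      · exact Or.inl (Or.inl ⟨i, hi.symm⟩)
      · exact Or.inr ⟨i, Or.inl hi⟩
      · exact Or.inr ⟨i, Or.inr hi⟩
      · exact Or.inl (Or.inr hi)
    have h1 : (Finset.univ.image c).card ≤ 5 := Finset.card_image_le.trans (by simp)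
    have h2 := Finset.card_le_card hsub
    have h3 := Finset.card_union_le (Finset.univ.image c ∪ Z) E
    have h4 := Finset.card_union_le (Finset.univ.image c) Z
    omega
  have hEle : E.card ≤ ∑ i, ((s i).toNat + (p i).toNat) := by
    have hsub : E ⊆ Finset.univ.biUnion fun i =>
        S.filter (IsTwin H c i) ∪ S.filter (IsPendant H c i) := by
      intro x hx
      simp only [hE, Finset.mem_filter] at hx
      obtain ⟨hxS, i, hi⟩ := hx
      simp only [Finset.mem_biUnion, Finset.mem_union, Finset.mem_filter, Finset.mem_univ, true_and]
      exact ⟨i, by tauto⟩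
    refine (Finset.card_le_card hsub).trans (Finset.card_biUnion_le.trans
      (Finset.sum_le_sum fun i _ => (Finset.card_union_le _ _).trans (Nat.add_le_add ?_ ?_)))
    · by_cases e : ∃ x ∈ S, IsTwin H c i x
      · simp only [hs, e, decide_true, Bool.toNat_true]
        refine Finset.card_le_one.2 fun x hx y hy => ?_
        simp only [Finset.mem_filter] at hx hy
        exact hc.twin_unique h hP hx.1 hy.1 hx.2 hy.2
      · simp only [hs, e, decide_false, Bool.toNat_false, Nat.le_zero, Finset.card_eq_zero]
        exact Finset.filter_eq_empty_iff.2 fun x hx hx' => e ⟨x, hx, hx'⟩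
    · by_cases e : ∃ x ∈ S, IsPendant H c i x
      · simp only [hp, e, decide_true, Bool.toNat_true]
        refine Finset.card_le_one.2 fun x hx y hy => ?_
        simp only [Finset.mem_filter] at hx hy
        exact hc.pendant_unique h hP hx.1 hy.1 hx.2 hy.2
      · simp only [hp, e, decide_false, Bool.toNat_false, Nat.le_zero, Finset.card_eq_zero]
        exact Finset.filter_eq_empty_iff.2 fun x hx hx' => e ⟨x, hx, hx'⟩
  obtain ⟨hp5, hp4, hp3⟩ := extras_pattern s p (fun i hi => by
    simp only [hs, hp, decide_eq_true_eq, decide_eq_false_iff_not] at hi ⊢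
    obtain ⟨x, hx, hxi⟩ := hi
    exact ⟨fun ⟨y, hy, hyi⟩ => hc.pendant_not_twin_succ h hP hx hy hxi hyi,
      fun ⟨y, hy, hyi⟩ => hc.pendant_not_twin_pred h hP hx hy hxi hyi⟩)
  have hZE : ∀ z ∈ Z, ∀ x ∈ E, H.Adj z x := by
    intro z hz x hx
    simp only [hZ, hE, Finset.mem_filter] at hz hx
    obtain ⟨hxS, i, hi | hi⟩ := hx
    · exact hc.far_adj_twin h hP hxS hz.2 hi
    · exact hc.far_adj_pendant h hP hz.2 hi
  have hZ2 : Z.card ≤ 2 := (h.mono (Finset.filter_subset _ _)).card_le_two_of_isClique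
    fun x hx y hy hne => by
      simp only [Finset.coe_filter, Set.mem_ofPred_eq] at hx hy
      exact hc.far_adj_far h hP hne hx.2 hy.2
  -- A far vertex sees all of `E`, so an edge inside `E` would close a triangle.
  have hEind : Z.Nonempty → H.IsIndepSet (E : Set V) := by
    rintro ⟨z, hz⟩ x hx y hy hne e
    exact h (Finset.mem_of_mem_filter z hz) (Finset.mem_of_mem_filter x hx)
      (Finset.mem_of_mem_filter y hy) (hZE z hz x hx) (hZE z hz y hy) e
  have hEa : Z.Nonempty → E.card ≤ a := fun hne => ha E (Finset.filter_subset _ _) (hEind hne)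
  have hZ2E : 2 ≤ Z.card → E.card = 0 := by
    intro h2
    obtain ⟨y, z, hy, hz, hyz⟩ := Finset.one_lt_card_iff.1 h2
    rw [Finset.card_eq_zero, Finset.eq_empty_iff_forall_notMem]
    intro x hx
    have h1 := (Finset.mem_filter.1 hy)
    have h2 := (Finset.mem_filter.1 hz)
    exact h h1.1 h2.1 (Finset.mem_of_mem_filter x hx) (hc.far_adj_far h hP hyz h1.2 h2.2)
      (hZE y hy x hx) (hZE z hz x hx)
  have ha2 : 2 ≤ a := by
    have := ha {c 0, c 2} (by simp [Finset.insert_subset_iff, hc.mem]) (by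
      intro x hx y hy hne
      simp only [Finset.coe_insert, Finset.coe_singleton, Set.mem_insert_iff,
        Set.mem_singleton_iff] at hx hy
      have h02 : ¬ H.Adj (c 0) (c 2) := hc.not_adj h 0
      rcases hx with rfl | rfl <;> rcases hy with rfl | rfl
      · exact absurd rfl hne
      · exact h02
      · exact fun e => h02 e.symm
      · exact absurd rfl hne)
    rwa [Finset.card_pair (hc.ne h (by decide))] at this
  have haZ : Z.Nonempty → 3 ≤ a := by
    rintro ⟨z, hz⟩
    have hz := Finset.mem_filter.1 hz
    exact ha.three_le hz.1 (hc.mem 0) (hc.mem 2) (hc.far_ne h hz.2 _) (hc.far_ne h hz.2 _)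
      (hc.ne h (by decide)) (fun e => hz.2 _ e.symm) (fun e => hz.2 _ e.symm) (hc.not_adj h 0)
  have haE : E.Nonempty → 3 ≤ a := by
    rintro ⟨x, hx⟩
    simp only [hE, Finset.mem_filter] at hx
    obtain ⟨hxS, i, hi | hi⟩ := hx
    · obtain ⟨h1, h2, h3⟩ := hc.twin_not_adj h hxS hi
      exact ha.three_le hxS (hc.mem i) (hc.mem (i + 2)) (hc.twin_ne h hxS hi _)
        (hc.twin_ne h hxS hi _) (hc.ne h (by clear hi h1 h2 h3; decide +revert))
        (fun e => h1 e.symm) (fun e => h2 e.symm) (hc.not_adj h i)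
    · refine ha.three_le hxS (hc.mem (i + 1)) (hc.mem (i + 3)) (hc.pendant_ne h hi _)
        (hc.pendant_ne h hi _) (hc.ne h ?_)
        (fun e => hi.2 _ ?_ e.symm) (fun e => hi.2 _ ?_ e.symm) ?_
      · clear hi; decide +revert
      · clear hi e; decide +revert
      · clear hi e; decide +revert
      · rw [hc.adj_iff h]; clear hi; decide +revert
  have ha4 : 4 ≤ E.card → 4 ≤ a := by
    intro h4
    obtain ⟨i, hi⟩ := hp4 (h4.trans hEle)
    simp only [hs, hp, decide_eq_true_eq] at hi
    rcases hi with ⟨⟨x, hx, hxi⟩, ⟨y, hy, hyi⟩⟩ | ⟨⟨x, hx, hxi⟩, ⟨y, hy, hyi⟩, ⟨z, hz, hzi⟩⟩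
    · exact hc.four_le_of_twins h ha hx hy hxi hyi
    · exact hc.four_le_of_pendants h hP ha hx hy hz hxi hyi hzi
  have haZ3 : Z.Nonempty → 3 ≤ E.card → 4 ≤ a := by
    intro hne h3
    have hmem : ∀ i x, x ∈ S → (IsTwin H c i x ∨ IsPendant H c i x) → x ∈ E := fun i x hx hi =>
      Finset.mem_filter.2 ⟨hx, i, hi⟩
    obtain ⟨i, hi⟩ := hp3 (h3.trans hEle)
    simp only [hs, hp, decide_eq_true_eq] at hi
    have hna : ∀ i j x y, x ∈ S → y ∈ S → IsTwin H c i x → IsPendant H c j y → ¬ H.Adj x y := by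
      intro i j x y hx hy hxi hyi e
      exact hEind hne (hmem i x hx (Or.inl hxi)) (hmem j y hy (Or.inr hyi)) e.ne e
    rcases hi with ⟨⟨x, hx, hxi⟩, ⟨y, hy, hyi⟩⟩ | ⟨⟨x, hx, hxi⟩, ⟨y, hy, hyi⟩⟩ |
      ⟨⟨x, hx, hxi⟩, ⟨y, hy, hyi⟩⟩ | ⟨⟨x, hx, hxi⟩, ⟨y, hy, hyi⟩⟩
    · exact hc.four_le_of_twins h ha hx hy hxi hyi
    · exact hc.four_le_of_twin_pendant h ha hx hy hxi hyi (hna _ _ x y hx hy hxi hyi)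
        (Or.inl ⟨rfl, rfl⟩)
    · exact hc.four_le_of_twin_pendant h ha hx hy hxi hyi (hna _ _ x y hx hy hxi hyi)
        (Or.inr ⟨rfl, rfl⟩)
    · have e := hc.pendant_adj_pendant h hP hxi hyi
      exact absurd e (hEind hne (hmem i x hx (Or.inr hxi)) (hmem _ y hy (Or.inr hyi)) e.ne)
  -- The bound to verify is 5 + |Z| + |E| ≤ 2a + 2. For |Z| = 0, the cases are |E| = 0, 1 ≤ |E| ≤ 3
  -- and 4 ≤ |E| ≤ 5, with a ≥ 2, 3, 4. For |Z| = 1, they are |E| ≤ 2, 3 ≤ |E| ≤ 4 and |E| = 5, with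
  -- a ≥ 3, 4, 5. For |Z| = 2, `E` is empty and a ≥ 3.
  simp only [← Finset.card_pos] at haE haZ haZ3 hEa
  omega

end IsPentagon

theorem TriangleFreeOn.card_le (h : TriangleFreeOn H S) (hP : NoEdgeWithTriple H) {a : ℕ}
    (ha : IndepLE H S a) : S.card ≤ 2 * a + 2 := by
  rcases card_le_or_isPentagon h hP ha with h1 | ⟨c, hc⟩
  · exact h1
  · exact hc.card_le h hP ha

/-- A complete bipartite graph with parts of size at most `a`. -/
theorem matchingLE_of_complete {P R : Finset V} {a : ℕ} (hP : P.card ≤ a) (hR : R.card ≤ a)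
    (hd : Disjoint P R) (hadj : ∀ x ∈ P, ∀ y ∈ R, H.Adj x y) : MatchingLE H (P ∪ R) a := by
  induction a generalizing P R with
  | zero =>
    rw [Finset.card_eq_zero.1 (Nat.le_zero.1 hP), Finset.card_eq_zero.1 (Nat.le_zero.1 hR)]
    simpa using matchingLE_card H (∅ : Finset V)
  | succ a ih =>
    rcases P.eq_empty_or_nonempty with rfl | ⟨x, hx⟩
    · simpa using (matchingLE_card H R).mono_right hR
    rcases R.eq_empty_or_nonempty with rfl | ⟨y, hy⟩
    · simpa using (matchingLE_card H P).mono_right hP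
    have hxR : x ∉ R := Finset.disjoint_left.1 hd hx
    have hyP : y ∉ P := Finset.disjoint_right.1 hd hy
    have h1 := ih (P := P.erase x) (R := R.erase y) (by rw [Finset.card_erase_of_mem hx]; omega)
      (by rw [Finset.card_erase_of_mem hy]; omega)
      (hd.mono (Finset.erase_subset _ _) (Finset.erase_subset _ _))
      (fun u hu v hv => hadj u (Finset.mem_of_mem_erase hu) v (Finset.mem_of_mem_erase hv))
    have h2 := h1.union (matchingLE_pair (hadj x hx y hy)) (by
      simp only [Finset.disjoint_insert_right, Finset.mem_union, Finset.mem_erase,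
        Finset.disjoint_singleton_right]
      tauto)
    convert h2 using 1
    ext z
    simp only [Finset.mem_union, Finset.mem_erase, Finset.mem_insert, Finset.mem_singleton]
    by_cases hzx : z = x
    · subst hzx; simp [hx]
    · by_cases hzy : z = y
      · subst hzy; simp [hy]
      · simp [hzx, hzy]

/-- If `S` and `C` are joined by no edge and `S` contains an edge and `C` two nonadjacent vertices,
then every edge of `S` dominates `S`, so that `S` is complete bipartite. -/
theorem matchingLE_of_separated (h : TriangleFreeOn H S) (hP : NoEdgeWithTriple H) {a : ℕ}
    (ha : IndepLE H S a) {u v p q : V} (hu : u ∈ S) (hv : v ∈ S) (huv : H.Adj u v) (hpq : p ≠ q)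
    (hpqn : ¬ H.Adj p q) (hp : p ∉ S) (hq : q ∉ S) (hSp : ∀ x ∈ S, ¬ H.Adj x p)
    (hSq : ∀ x ∈ S, ¬ H.Adj x q) : MatchingLE H S a := by
  classical
  have hdom : ∀ x ∈ S, ∀ y ∈ S, ∀ w ∈ S, H.Adj x y → H.Adj x w ∨ H.Adj y w := by
    intro x hx y hy w hw hxy
    by_contra! hc
    exact hP hxy (x := w) (y := p) (z := q) (fun e => hp (e ▸ hw)) (fun e => hq (e ▸ hw)) hpq
      (hSp w hw) (hSq w hw) hpqn hc.1 (hSp x hx) (hSq x hx) hc.2 (hSp y hy) (hSq y hy)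
  have hS : S = S.filter (H.Adj u) ∪ S.filter (H.Adj v) := by
    ext x
    simp only [Finset.mem_union, Finset.mem_filter]
    have := hdom u hu v hv x
    tauto
  rw [hS]
  refine matchingLE_of_complete (ha _ (Finset.filter_subset _ _) (h.isIndepSet_neighbors hu))
    (ha _ (Finset.filter_subset _ _) (h.isIndepSet_neighbors hv)) ?_ ?_
  · refine Finset.disjoint_left.2 fun x hx hx' => ?_
    simp only [Finset.mem_filter] at hx hx'
    exact h hu hv hx.1 huv hx.2 hx'.2
  · intro x hx y hy
    simp only [Finset.mem_filter] at hx hy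
    rcases hdom u hu x hx.1 y hy.1 hx.2 with e | e
    · exact absurd e fun e => h hu hv hy.1 huv e hy.2
    · exact e

/-- When `S` and `C` are joined by no edge, one of them is matched as well as possible. -/
theorem matchingLE_or_of_separated {C : Finset V} (h : TriangleFreeOn H S) (h' : TriangleFreeOn H C)
    (hP : NoEdgeWithTriple H) {a b : ℕ} (ha : IndepLE H S a) (hb : IndepLE H C b)
    (hd : Disjoint S C) (hSC : ∀ x ∈ S, ∀ y ∈ C, ¬ H.Adj x y) :
    MatchingLE H S a ∨ MatchingLE H C b := by
  by_cases hS : ∃ u ∈ S, ∃ v ∈ S, H.Adj u v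
  · obtain ⟨u, hu, v, hv, huv⟩ := hS
    by_cases hC : ∃ p ∈ C, ∃ q ∈ C, p ≠ q ∧ ¬ H.Adj p q
    · obtain ⟨p, hp, q, hq, hpq, hn⟩ := hC
      exact Or.inl (matchingLE_of_separated h hP ha hu hv huv hpq hn (Finset.disjoint_right.1 hd hp)
        (Finset.disjoint_right.1 hd hq) (fun x hx => hSC x hx p hp) fun x hx => hSC x hx q hq)
    · push Not at hC
      right
      -- Here `C` is a clique of at most two vertices, so a single edge or vertex covers it, and b ≥
      -- 1 unless `C` is empty.
      have h2 := h'.card_le_two_of_isClique fun x hx y hy hne => hC x hx y hy hne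
      rcases C.eq_empty_or_nonempty with rfl | ⟨p, hp⟩
      · exact (matchingLE_card H (∅ : Finset V)).mono_right (by simp)
      have hb1 := hb {p} (by simpa using hp) (by simp)
      rw [Finset.card_singleton] at hb1
      by_cases h3 : C.card = 2
      · obtain ⟨x, y, hxy, rfl⟩ := Finset.card_eq_two.1 h3
        exact (matchingLE_pair (hC x (by simp) y (by simp) hxy)).mono_right hb1
      · exact (matchingLE_card H C).mono_right (by omega)
  · push Not at hS
    exact Or.inl ((matchingLE_card H S).mono_right
      (ha S subset_rfl fun x hx y hy _ => hS x hx y hy))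

theorem TriangleFreeOn.matchingLE (h : TriangleFreeOn H S) (hP : NoEdgeWithTriple H) {a : ℕ}
    (ha : IndepLE H S a) : MatchingLE H S (a + 1) := by
  classical
  induction hn : S.card using Nat.strong_induction_on generalizing S a with
  | _ n ih =>
  subst hn
  obtain ⟨f, hf, hfm⟩ := exists_isMatchingOn_min H S
  refine ⟨f, hf, ?_⟩
  obtain ⟨m, hm⟩ := hf.even_card_add
  by_cases hall : ∀ t ∈ S, ∃ g, IsMatchingOn H S g ∧ unmatched S g = unmatched S f ∧ g t = t
  · by_cases h2 : 2 ≤ unmatched S f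
    · obtain ⟨C, hCS, hC, hC', hsep⟩ := gallai_split hf hfm hall h2
      obtain ⟨K, hK, hKi, hKm⟩ := exists_indepLE H C
      obtain ⟨L, hL, hLi, hLm⟩ := exists_indepLE H (S \ C)
      have hle : K.card + L.card ≤ a := by
        rw [← Finset.card_union_of_disjoint (Finset.disjoint_sdiff.mono hK hL)]
        refine ha _ (Finset.union_subset (hK.trans hCS) (hL.trans Finset.sdiff_subset)) ?_
        intro x hx y hy hne
        simp only [Finset.coe_union, Set.mem_union, Finset.mem_coe] at hx hy
        rcases hx with hx | hx <;> rcases hy with hy | hy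
        · exact hKi hx hy hne
        · exact hsep x (hK hx) y (hL hy)
        · exact fun e => hsep y (hK hy) x (hL hx) e.symm
        · exact hLi hx hy hne
      have hcard := Finset.card_sdiff_add_card_eq_card hCS
      have hCpos := Finset.card_pos.2 hC
      have hCpos' := Finset.card_pos.2 hC'
      have hM1 := ih C.card (by omega) (h.mono hCS) hKm rfl
      have hM2 := ih (S \ C).card (by omega) (h.mono Finset.sdiff_subset) hLm rfl
      -- Independence numbers add over the split. Two inductive bounds would cost +2, but one side
      -- needs no +1.
      have hM : MatchingLE H (C ∪ S \ C) (a + 1) := by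
        rcases matchingLE_or_of_separated (h.mono hCS) (h.mono Finset.sdiff_subset) hP hKm hLm
          Finset.disjoint_sdiff hsep with h1 | h1
        · exact (h1.union hM2 Finset.disjoint_sdiff).mono_right (by omega)
        · exact (hM1.union h1 Finset.disjoint_sdiff).mono_right (by omega)
      rw [Finset.union_sdiff_of_subset hCS] at hM
      obtain ⟨g, hg, hgk⟩ := hM
      have := hfm g hg
      omega
    -- With at most one unmatched vertex the total is at most 2a + 3, and parity lowers this to 2a +
    -- 2.
    · have := h.card_le hP ha
      omega
  -- Every optimal matching covers `t`, so a matching of `S.erase t` is not optimal on `S` and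
  -- leaves more vertices of `S` unmatched. Up to parity, the inductive bound for `S.erase t`
  -- therefore carries over to `S`.
  · push Not at hall
    obtain ⟨t, ht, hall⟩ := hall
    have hcard := Finset.card_erase_add_one ht
    obtain ⟨g, hg, hgk⟩ := ih (S.erase t).card (by omega) (h.mono (Finset.erase_subset _ _))
      (ha.mono (Finset.erase_subset _ _) le_rfl) rfl
    have hgt : g t = t := hg.fix t (by simp)
    have hg' := hg.mono (Finset.erase_subset t S)
    have h1 : unmatched S g = unmatched (S.erase t) g + 1 := by
      unfold unmatched
      rw [Finset.filter_erase, Finset.card_erase_add_one (by simp [ht, hgt])]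
    have h2 := hfm g hg'
    have h3 : unmatched S g ≠ unmatched S f := fun e => hall g hg' e hgt
    obtain ⟨r, hr⟩ := hg.even_card_add
    omega

end TriangleFreeBound

/-! ### Diamond-free sets with bounded cliques -/

section BoundedCliques

variable {V : Type*} [DecidableEq V] {H : SimpleGraph V} {S T : Finset V}

/-- Every clique contained in `S` has at most `k` vertices. -/
def CliqueLE (H : SimpleGraph V) (S : Finset V) (k : ℕ) : Prop :=
  ∀ R ⊆ S, H.IsClique (R : Set V) → R.card ≤ k

theorem CliqueLE.mono {k : ℕ} (h : CliqueLE H S k) (hT : T ⊆ S) : CliqueLE H T k :=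
  fun R hR => h R (hR.trans hT)

/-- In a diamond-free graph, a vertex outside a maximum clique has at most one neighbour in it. -/
theorem DiamondFree.eq_of_adj_clique (hD : DiamondFree H) {Q : Finset V}
    (hQ : H.IsClique (Q : Set V)) (hQS : Q ⊆ S) (hmax : CliqueLE H S Q.card) {x y z : V}
    (hx : x ∈ S) (hxQ : x ∉ Q) (hy : y ∈ Q) (hz : z ∈ Q) (hxy : H.Adj x y) (hxz : H.Adj x z) :
    y = z := by
  by_contra hne
  have hyz : H.Adj y z := hQ hy hz hne
  have hall : ∀ w ∈ Q, H.Adj x w := by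
    intro w hw
    by_cases hwy : w = y
    · rwa [hwy]
    by_cases hwz : w = z
    · rwa [hwz]
    exact hD hyz hxy hxz (hQ hw hy hwy) (hQ hw hz hwz) fun e => hxQ (e ▸ hw)
  have := hmax (insert x Q) (Finset.insert_subset hx hQS) (by
    rw [Finset.coe_insert, SimpleGraph.isClique_insert]
    exact ⟨hQ, fun w hw _ => hall w hw⟩)
  rw [Finset.card_insert_of_notMem hxQ] at this
  omega

/-- The neighbourhoods in `K` of the vertices of `Q` are pairwise disjoint. -/
theorem card_mul_le_of_unique_neighbor [DecidableRel H.Adj] {Q K : Finset V} {m : ℕ}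
    (huniq : ∀ y ∈ K, ∀ p ∈ Q, ∀ q ∈ Q, H.Adj y p → H.Adj y q → p = q)
    (hm : ∀ q ∈ Q, m ≤ (K.filter (H.Adj q)).card) : Q.card * m ≤ K.card := by
  have h1 : (Q.biUnion fun q => K.filter (H.Adj q)).card = ∑ q ∈ Q, (K.filter (H.Adj q)).card := by
    refine Finset.card_biUnion fun p hp q hq hne => Finset.disjoint_left.2 fun y hy hy' => ?_
    simp only [Finset.mem_filter] at hy hy'
    exact hne (huniq y hy.1 p hp q hq hy.2.symm hy'.2.symm)
  calc Q.card * m ≤ ∑ q ∈ Q, (K.filter (H.Adj q)).card := by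
        simpa using Finset.card_nsmul_le_sum Q _ m hm
    _ ≤ K.card := by
        rw [← h1]
        exact Finset.card_le_card (Finset.biUnion_subset.2 fun q _ => Finset.filter_subset _ _)

theorem not_triangleFreeOn (h : ¬ TriangleFreeOn H S) : ∃ Q ⊆ S, H.IsNClique 3 Q := by
  unfold TriangleFreeOn at h
  push Not at h
  obtain ⟨x, y, z, hx, hy, hz, hxy, hxz, hyz, -⟩ := h
  exact ⟨{x, y, z}, by simp [Finset.insert_subset_iff, *],
    SimpleGraph.is3Clique_iff.2 ⟨x, y, z, hxy, hxz, hyz, rfl⟩⟩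

theorem DiamondFree.eq_of_adj_triangle (hD : DiamondFree H) (h3 : CliqueLE H S 3) {Q : Finset V}
    (hQ : H.IsNClique 3 Q) (hQS : Q ⊆ S) {x y z : V}
    (hx : x ∈ S) (hxQ : x ∉ Q) (hy : y ∈ Q) (hz : z ∈ Q) (hxy : H.Adj x y) (hxz : H.Adj x z) :
    y = z :=
  hD.eq_of_adj_clique hQ.isClique hQS (hQ.card_eq ▸ h3) hx hxQ hy hz hxy hxz

theorem DiamondFree.card_neighbors_triangle_le [DecidableRel H.Adj] (hD : DiamondFree H)
    (h3 : CliqueLE H S 3) {Q : Finset V} (hQ : H.IsNClique 3 Q) (hQS : Q ⊆ S) {x : V} (hx : x ∈ S)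
    (hxQ : x ∉ Q) : (Q.filter (H.Adj x)).card ≤ 1 := by
  refine Finset.card_le_one.2 fun y hy z hz => ?_
  simp only [Finset.mem_filter] at hy hz
  exact hD.eq_of_adj_triangle h3 hQ hQS hx hxQ hy.1 hz.1 hy.2 hz.2

/-- Each outside vertex sees at most one of the three triangle vertices, so two of them leave one
unseen. -/
theorem DiamondFree.exists_nonadj_triangle (hD : DiamondFree H) (h3 : CliqueLE H S 3)
    {Q : Finset V} (hQ : H.IsNClique 3 Q) (hQS : Q ⊆ S) {x y : V} (hx : x ∈ S) (hxQ : x ∉ Q)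
    (hy : y ∈ S) (hyQ : y ∉ Q) : ∃ q ∈ Q, ¬ H.Adj x q ∧ ¬ H.Adj y q := by
  classical
  by_contra! hc
  have h1 := hD.card_neighbors_triangle_le h3 hQ hQS hx hxQ
  have h2 := hD.card_neighbors_triangle_le h3 hQ hQS hy hyQ
  have hsub : Q ⊆ Q.filter (H.Adj x) ∪ Q.filter (H.Adj y) := by
    intro q hq
    simp only [Finset.mem_union, Finset.mem_filter]
    have := hc q hq
    tauto
  have h4 := (Finset.card_le_card hsub).trans (Finset.card_union_le _ _)
  rw [hQ.card_eq] at h4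
  omega

/-- Two common neighbours of the ends of an edge coincide when there is no clique of size four. -/
theorem DiamondFree.common_neighbor_unique (hD : DiamondFree H) (h3 : CliqueLE H S 3) {u v x y : V}
    (hu : u ∈ S) (hv : v ∈ S) (hx : x ∈ S) (hy : y ∈ S) (huv : H.Adj u v) (hxu : H.Adj x u)
    (hxv : H.Adj x v) (hyu : H.Adj y u) (hyv : H.Adj y v) : x = y := by
  by_contra hne
  have hxy := hD huv hxu hxv hyu hyv hne
  have := h3 {x, y, u, v} (by simp [Finset.insert_subset_iff, *]) (by
    simp only [Finset.coe_insert, Finset.coe_singleton, SimpleGraph.isClique_insert]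
    simp [hxy, hxu, hxv, hyu, hyv, huv])
  rw [card_four hne hxu.ne hxv.ne hyu.ne hyv.ne huv.ne] at this
  omega

/-- With independence number two, six vertices split into two triangles, and there are no more. -/
theorem DiamondFree.split_triangles (hD : DiamondFree H) (h3 : CliqueLE H S 3)
    (h2 : IndepLE H S 2) :
    S.card ≤ 6 ∧ (S.card = 6 → ∃ T ⊆ S, H.IsNClique 3 T ∧ H.IsNClique 3 (S \ T)) := by
  by_cases h : TriangleFreeOn H S
  · have := h.card_le_five h2
    exact ⟨by omega, by omega⟩
  obtain ⟨T, hTS, hT⟩ := not_triangleFreeOn h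
  have hcl : H.IsClique ((S \ T : Finset V) : Set V) := by
    intro x hx y hy hne
    simp only [Finset.coe_sdiff, Set.mem_sdiff, Finset.mem_coe] at hx hy
    obtain ⟨t, ht, h4, h5⟩ := hD.exists_nonadj_triangle h3 hT hTS hx.1 hx.2 hy.1 hy.2
    rcases h2.adj_of_two hx.1 hy.1 (hTS ht) hne (fun e => hx.2 (e ▸ ht)) (fun e => hy.2 (e ▸ ht))
      with e | e | e
    · exact e
    · exact absurd e h4
    · exact absurd e h5
  have hle := h3 _ Finset.sdiff_subset hcl
  have hcard := Finset.card_sdiff_add_card_eq_card hTS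
  rw [hT.card_eq] at hcard
  exact ⟨by omega, fun h6 => ⟨T, hTS, hT, hcl, by omega⟩⟩

theorem IndepLE.nonneighbors [DecidableRel H.Adj] {a : ℕ} (h : IndepLE H S (a + 1)) {v : V}
    (hv : v ∈ S) : IndepLE H (S.filter fun x => x ≠ v ∧ ¬ H.Adj v x) a := by
  intro K hK hi
  have hvK : v ∉ K := fun e => (Finset.mem_filter.1 (hK e)).2.1 rfl
  have := h (insert v K) (Finset.insert_subset hv (hK.trans (Finset.filter_subset _ _))) (by
    intro x hx y hy hne
    simp only [Finset.coe_insert, Set.mem_insert_iff, Finset.mem_coe] at hx hy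
    rcases hx with rfl | hx <;> rcases hy with rfl | hy
    · exact absurd rfl hne
    · exact (Finset.mem_filter.1 (hK hy)).2.2
    · exact fun e => (Finset.mem_filter.1 (hK hx)).2.2 e.symm
    · exact hi hx hy hne)
  rw [Finset.card_insert_of_notMem hvK] at this
  omega

/-- The non-neighbours of `v` have independence number at most two, so there are at most six of
them; six means two disjoint triangles. -/
theorem DiamondFree.card_le_degree_add [DecidableRel H.Adj] (hD : DiamondFree H)
    (h3 : CliqueLE H S 3) (ha : IndepLE H S 3) {v : V} (hv : v ∈ S) :
    S.card ≤ (S.filter (H.Adj v)).card + 7 ∧ (S.card = (S.filter (H.Adj v)).card + 7 →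
      ∃ T T' : Finset V, T ⊆ S ∧ T' ⊆ S ∧ H.IsNClique 3 T ∧ H.IsNClique 3 T' ∧ Disjoint T T' ∧
        (∀ x ∈ T, x ≠ v ∧ ¬ H.Adj v x) ∧ (∀ x ∈ T', x ≠ v ∧ ¬ H.Adj v x) ∧
        S = insert v (S.filter (H.Adj v)) ∪ (T ∪ T')) := by
  have h1 := card_eq_neighbors_add (H := H) hv
  obtain ⟨h4, h5⟩ := hD.split_triangles (h3.mono (Finset.filter_subset _ _)) (ha.nonneighbors hv)
  refine ⟨by omega, fun h6 => ?_⟩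
  obtain ⟨T, hT, hT3, hT3'⟩ := h5 (by omega)
  have hsub := Finset.filter_subset (fun x => x ≠ v ∧ ¬ H.Adj v x) S
  refine ⟨T, _, hT.trans hsub, Finset.sdiff_subset.trans hsub, hT3, hT3', Finset.disjoint_sdiff,
    fun x hx => (Finset.mem_filter.1 (hT hx)).2,
    fun x hx => (Finset.mem_filter.1 (Finset.sdiff_subset hx)).2, ?_⟩
  rw [Finset.union_sdiff_of_subset hT]
  ext x
  simp only [Finset.mem_union, Finset.mem_insert, Finset.mem_filter]
  by_cases e : x = v
  · simp [e, hv]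
  · by_cases e' : H.Adj v x <;> simp [e, e']

theorem card_filter_le_of_subset_union [DecidableRel H.Adj] {A B : Finset V} (hS : S ⊆ A ∪ B)
    (v : V) : (S.filter (H.Adj v)).card ≤ (A.filter (H.Adj v)).card + (B.filter (H.Adj v)).card :=
  (Finset.card_le_card ((Finset.filter_subset_filter _ hS).trans
    (Finset.filter_union _ _ _).subset)).trans (Finset.card_union_le _ _)

theorem exists_triangle_of_degree [DecidableRel H.Adj] (ha : IndepLE H S 3) {v : V}
    (h4 : 4 ≤ (S.filter (H.Adj v)).card) : ∃ y ∈ S, ∃ z ∈ S, H.Adj v y ∧ H.Adj v z ∧ H.Adj y z := by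
  by_contra! hc
  have := ha (S.filter (H.Adj v)) (Finset.filter_subset _ _) fun y hy z hz _ => by
    simp only [Finset.coe_filter, Set.mem_ofPred_eq] at hy hz
    exact hc y hy.1 z hz.1 hy.2 hz.2
  omega

theorem exists_isNClique_of_degree [DecidableRel H.Adj] (ha : IndepLE H S 3) {v : V} (hv : v ∈ S)
    (h4 : 4 ≤ (S.filter (H.Adj v)).card) : ∃ Q ⊆ S, H.IsNClique 3 Q := by
  obtain ⟨y, hy, z, hz, h1, h2, h3⟩ := exists_triangle_of_degree ha h4
  exact not_triangleFreeOn fun h => h hv hy hz h1 h2 h3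

theorem IndepLE.adj_of_four (ha : IndepLE H S 3) {x y z w : V} (hx : x ∈ S) (hy : y ∈ S)
    (hz : z ∈ S) (hw : w ∈ S) (hxy : x ≠ y) (hxz : x ≠ z) (hxw : x ≠ w) (hyz : y ≠ z)
    (hyw : y ≠ w) (hzw : z ≠ w) (h1 : ¬ H.Adj x y) (h2 : ¬ H.Adj x z) (h3 : ¬ H.Adj x w)
    (h4 : ¬ H.Adj y z) (h5 : ¬ H.Adj y w) : H.Adj z w := by
  by_contra h6
  have := ha.four_le hx hy hz hw hxy hxz hxw hyz hyw hzw h1 h2 h3 h4 h5 h6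
  omega

/-- The Ramsey bound `R(K₄ - e, K₄) ≤ 11`, for graphs without `K₄`. -/
theorem DiamondFree.card_le_ten (hD : DiamondFree H) (h3 : CliqueLE H S 3) (ha : IndepLE H S 3) :
    S.card ≤ 10 := by
  classical
  by_contra! hlt
  obtain ⟨S', hS', hcard⟩ := Finset.exists_subset_card_eq (show 11 ≤ S.card by omega)
  replace h3 := h3.mono hS'
  replace ha := ha.mono hS' le_rfl
  clear hlt hS'
  have hdeg : ∀ v ∈ S', 4 ≤ (S'.filter (H.Adj v)).card := fun v hv => by
    have := (hD.card_le_degree_add h3 ha hv).1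
    omega
  by_cases h4 : ∃ v ∈ S', (S'.filter (H.Adj v)).card = 4
  · obtain ⟨v, hv, hd⟩ := h4
    obtain ⟨T, T', hTS, hTS', hT, hT', hTT, hvT, hvT', hun⟩ :=
      (hD.card_le_degree_add h3 ha hv).2 (by omega)
    set N := S'.filter (H.Adj v) with hN
    have hNT : ∀ u ∈ N, u ∉ T := fun u hu h => (hvT u h).2 (Finset.mem_filter.1 hu).2
    have hNT' : ∀ u ∈ N, u ∉ T' := fun u hu h => (hvT' u h).2 (Finset.mem_filter.1 hu).2
    -- Of the at least four neighbours of `u`, one is `v`, at most one lies in `N` and at most one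
    -- in `T'`, which leaves one in `T`.
    have hex : ∀ u ∈ N, ∃ t ∈ T, H.Adj u t := by
      intro u hu
      have huS := (Finset.mem_filter.1 hu).1
      have hvu := (Finset.mem_filter.1 hu).2
      have hN1 : (N.filter (H.Adj u)).card ≤ 1 := by
        refine Finset.card_le_one.2 fun y hy z hz => ?_
        simp only [hN, Finset.mem_filter] at hy hz
        exact hD.common_neighbor_unique h3 huS hv hy.1.1 hz.1.1 hvu.symm hy.2.symm hy.1.2.symm
          hz.2.symm hz.1.2.symm
      have hT1 := hD.card_neighbors_triangle_le h3 hT' hTS' huS (hNT' u hu)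
      have h5 := card_filter_le_of_subset_union (H := H) hun.subset u
      have h6 := card_filter_le_of_subset_union (H := H) (subset_refl (T ∪ T')) u
      have h7 := card_filter_le_of_subset_union (H := H) (Finset.insert_eq v N).subset u
      have h8 : (({v} : Finset V).filter (H.Adj u)).card ≤ 1 :=
        (Finset.card_filter_le _ _).trans (by simp)
      have h9 := hdeg u huS
      obtain ⟨t, ht⟩ := Finset.card_pos.1 (by omega : 0 < (T.filter (H.Adj u)).card)
      exact ⟨t, (Finset.mem_filter.1 ht).1, (Finset.mem_filter.1 ht).2⟩
    choose! t htT htadj using hex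
    -- If `u` and `w` share a neighbour in `T`, then adjacency would make a diamond with `v`.
    -- Otherwise some `r` in `T'` misses both and must see the other two vertices of `T`, one too
    -- many. Injectivity is absurd because |N| = 4 and |T| = 3.
    have hinj : Set.InjOn t N := by
      intro u hu w hw he
      by_contra hne
      have huS := (Finset.mem_filter.1 hu).1
      have hvu := (Finset.mem_filter.1 hu).2
      have hwS := (Finset.mem_filter.1 hw).1
      have hvw := (Finset.mem_filter.1 hw).2
      by_cases huw : H.Adj u w
      · exact (hvT _ (htT u hu)).2 (hD huw hvu hvw (htadj u hu).symm (he ▸ (htadj w hw).symm)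
          (hvT _ (htT u hu)).1.symm)
      · obtain ⟨r, hr, hur, hwr⟩ :=
          hD.exists_nonadj_triangle h3 hT' hTS' huS (hNT' u hu) hwS (hNT' w hw)
        have hrT : r ∉ T := Finset.disjoint_right.1 hTT hr
        have key : ∀ s ∈ T.erase (t u), H.Adj r s := by
          intro s hs
          have hsT := Finset.mem_of_mem_erase hs
          have hsu : ¬ H.Adj u s := fun e => Finset.ne_of_mem_erase hs
            (hD.eq_of_adj_triangle h3 hT hTS huS (hNT u hu) hsT (htT u hu) e (htadj u hu))
          have hsw : ¬ H.Adj w s := fun e => Finset.ne_of_mem_erase hs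
            (hD.eq_of_adj_triangle h3 hT hTS hwS (hNT w hw) hsT (htT u hu) e (he ▸ htadj w hw))
          exact ha.adj_of_four huS hwS (hTS' hr) (hTS hsT) hne (fun e => hNT' u hu (e ▸ hr))
            (fun e => hNT u hu (e ▸ hsT)) (fun e => hNT' w hw (e ▸ hr))
            (fun e => hNT w hw (e ▸ hsT)) (fun e => hrT (e ▸ hsT)) huw hur hsu hwr hsw
        obtain ⟨s, s', hs, hs', hss⟩ := Finset.one_lt_card_iff.1
          (by rw [Finset.card_erase_of_mem (htT u hu), hT.card_eq]; omega : 1 < (T.erase (t u)).card)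
        exact hss (hD.eq_of_adj_triangle h3 hT hTS (hTS' hr) hrT (Finset.mem_of_mem_erase hs)
          (Finset.mem_of_mem_erase hs') (key s hs) (key s' hs'))
    have := Finset.card_le_card_of_injOn t htT hinj
    rw [hT.card_eq] at this
    omega
  · push Not at h4
    obtain ⟨v, hv⟩ : S'.Nonempty := Finset.card_pos.1 (by omega)
    -- All degrees are now at least five, so each vertex of the triangle has at least three private
    -- neighbours outside, while only eight vertices are available.
    obtain ⟨Q, hQS, hQ⟩ := exists_isNClique_of_degree ha hv (hdeg v hv)
    have := card_mul_le_of_unique_neighbor (H := H) (Q := Q) (K := S' \ Q) (m := 3)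
      (fun y hy p hp q hq h1 h2 => hD.eq_of_adj_triangle h3 hQ hQS (Finset.mem_sdiff.1 hy).1
        (Finset.mem_sdiff.1 hy).2 hp hq h1 h2) (fun q hq => by
        have h5 := hdeg q (hQS hq)
        have h6 := h4 q (hQS hq)
        have h7 := card_filter_le_of_subset_union (H := H) (Finset.union_sdiff_of_subset hQS).superset q
        have h8 : (Q.filter (H.Adj q)).card ≤ 2 := by
          have : Q.filter (H.Adj q) ⊆ Q.erase q := fun x hx => by
            simp only [Finset.mem_filter] at hx
            exact Finset.mem_erase.2 ⟨hx.2.ne', hx.1⟩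
          have := Finset.card_le_card this
          rwa [Finset.card_erase_of_mem hq, hQ.card_eq] at this
        omega)
    have h5 := Finset.card_sdiff_add_card_eq_card hQS
    rw [hQ.card_eq] at this h5
    omega

end BoundedCliques

/-! ### Covering by four cliques when a and the clique bound are three -/

section SmallCase

variable {V : Type*} [DecidableEq V] {H : SimpleGraph V} {S T : Finset V}

theorem cliqueCover_pair_add {k : ℕ} {x y : V} (h : H.Adj x y) (hc : CliqueCover H (S \ {x, y}) k) :
    CliqueCover H S (k + 1) :=
  hc.add_clique h.isClique_pair

theorem card_sdiff_pair {x y : V} (hx : x ∈ S) (hy : y ∈ S) (hne : x ≠ y) :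
    (S \ {x, y}).card + 2 = S.card := by
  have := Finset.card_sdiff_add_card_eq_card
    (show ({x, y} : Finset V) ⊆ S by simp [Finset.insert_subset_iff, hx, hy])
  rwa [Finset.card_pair hne] at this

theorem cliqueCover_of_card_le_five (ha : IndepLE H S 3) (h5 : S.card ≤ 5) :
    CliqueCover H S 3 := by
  by_cases hle : S.card ≤ 3
  · exact cliqueCover_card hle
  by_cases he : ∃ x ∈ S, ∃ y ∈ S, H.Adj x y
  swap
  · push Not at he
    exact absurd (ha S subset_rfl fun x hx y hy _ => he x hx y hy) hle
  obtain ⟨x, hx, y, hy, hxy⟩ := he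
  have hcard := card_sdiff_pair hx hy hxy.ne
  by_cases h2 : (S \ {x, y}).card ≤ 2
  · exact cliqueCover_pair_add hxy (cliqueCover_card h2)
  by_cases he : ∃ u ∈ S \ {x, y}, ∃ v ∈ S \ {x, y}, H.Adj u v
  · obtain ⟨u, hu, v, hv, huv⟩ := he
    have := card_sdiff_pair hu hv huv.ne
    exact cliqueCover_pair_add hxy (cliqueCover_pair_add huv (cliqueCover_card (by omega)))
  push Not at he
  have hthree : (S \ {x, y}).card = 3 := by omega
  have hnbr : ∀ v ∈ ({x, y} : Finset V), v ∈ S → ∃ u ∈ S \ {x, y}, H.Adj v u := by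
    intro v hv hvS
    by_contra! hc
    have hvn : v ∉ S \ {x, y} := fun e => (Finset.mem_sdiff.1 e).2 hv
    have := ha (insert v (S \ {x, y})) (Finset.insert_subset hvS Finset.sdiff_subset) (by
      intro a ha b hb hne
      rw [Finset.coe_insert, Set.mem_insert_iff, Finset.mem_coe] at ha hb
      rcases ha with rfl | ha <;> rcases hb with rfl | hb
      · exact absurd rfl hne
      · exact hc b hb
      · exact fun e => hc a ha e.symm
      · exact he a ha b hb)
    rw [Finset.card_insert_of_notMem hvn] at this
    omega
  obtain ⟨u, hu, hxu⟩ := hnbr x (by simp) hx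
  obtain ⟨v, hv, hyv⟩ := hnbr y (by simp) hy
  simp only [Finset.mem_sdiff, Finset.mem_insert, Finset.mem_singleton, not_or] at hu hv
  by_cases huv : u = v
  · subst huv
    refine CliqueCover.add_clique (Q := {x, y, u}) ?_ (cliqueCover_card ?_)
    · exact (SimpleGraph.is3Clique_iff.2 ⟨x, y, u, hxy, hxu, hyv, rfl⟩ : H.IsNClique 3 _).isClique
    · have := Finset.card_sdiff_add_card_eq_card
        (show ({x, y, u} : Finset V) ⊆ S by simp [Finset.insert_subset_iff, hx, hy, hu.1])
      rw [Finset.card_eq_three.2 ⟨x, y, u, hxy.ne, hxu.ne, hyv.ne, rfl⟩] at this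
      omega
  · have h1 := card_sdiff_pair hx hu.1 hxu.ne
    have h2 := card_sdiff_pair (S := S \ {x, u}) (x := y) (y := v)
      (by simp [hy, hxy.ne', Ne.symm hu.2.2])
      (by simp [hv.1, hv.2.1, Ne.symm huv]) hyv.ne
    exact cliqueCover_pair_add hxu (cliqueCover_pair_add hyv (cliqueCover_card (by omega)))

/-- A bipartite graph on `3 + 3` vertices with degrees at least two on one side and no isolated
vertex on the other has a perfect matching. -/
theorem exists_transversal {α β : Type*} (R : α → β → Prop) {x y z : α} {p q r : β}
    (hx : (R x p ∧ R x q) ∨ (R x p ∧ R x r) ∨ (R x q ∧ R x r))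
    (hy : (R y p ∧ R y q) ∨ (R y p ∧ R y r) ∨ (R y q ∧ R y r))
    (hz : (R z p ∧ R z q) ∨ (R z p ∧ R z r) ∨ (R z q ∧ R z r))
    (hp : R x p ∨ R y p ∨ R z p) (hq : R x q ∨ R y q ∨ R z q) (hr : R x r ∨ R y r ∨ R z r) :
    (R x p ∧ ((R y q ∧ R z r) ∨ (R y r ∧ R z q))) ∨ (R x q ∧ ((R y p ∧ R z r) ∨ (R y r ∧ R z p))) ∨
      (R x r ∧ ((R y p ∧ R z q) ∨ (R y q ∧ R z p))) := by
  grind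

theorem two_of_three [DecidableRel H.Adj] {x p q r : V}
    (h : 2 ≤ (({p, q, r} : Finset V).filter (H.Adj x)).card) :
    (H.Adj x p ∧ H.Adj x q) ∨ (H.Adj x p ∧ H.Adj x r) ∨ (H.Adj x q ∧ H.Adj x r) := by
  obtain ⟨u, v, hu, hv, huv⟩ := Finset.one_lt_card_iff.1 h
  simp only [Finset.mem_filter, Finset.mem_insert, Finset.mem_singleton] at hu hv
  obtain ⟨rfl | rfl | rfl, hu⟩ := hu <;> obtain ⟨rfl | rfl | rfl, hv⟩ := hv <;> tauto

theorem cliqueCover_three_pairs {x y z p q r : V} (h1 : H.Adj x p) (h2 : H.Adj y q)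
    (h3 : H.Adj z r) (hS : S ⊆ {x, y, z} ∪ {p, q, r}) : CliqueCover H S 3 := by
  refine (((cliqueCover_one h1.isClique_pair).union (cliqueCover_one h2.isClique_pair)).union
    (cliqueCover_one h3.isClique_pair)).mono (fun w hw => ?_) le_rfl
  have := hS hw
  simp only [Finset.mem_union, Finset.mem_insert, Finset.mem_singleton] at this ⊢
  tauto

theorem DiamondFree.cliqueCover_of_card_eq_nine (hD : DiamondFree H) (h3 : CliqueLE H S 3)
    (ha : IndepLE H S 3) {Q : Finset V} (hQS : Q ⊆ S) (hQ : H.IsNClique 3 Q) (h9 : S.card = 9) :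
    CliqueCover H S 4 := by
  classical
  by_cases h2 : ∃ v ∈ S, (S.filter (H.Adj v)).card = 2
  · obtain ⟨v, hv, hd⟩ := h2
    -- Degree two leaves six non-neighbours, which split into two triangles.
    obtain ⟨T, T', -, -, hT, hT', -, -, -, hun⟩ :=
      (hD.card_le_degree_add h3 ha hv).2 (by omega)
    have hN : CliqueCover H (insert v (S.filter (H.Adj v))) 2 := by
      obtain ⟨a, b, hab, he⟩ := Finset.card_eq_two.1 hd
      have hva : H.Adj v a := (Finset.mem_filter.1 (he ▸ (by simp : a ∈ ({a, b} : Finset V)))).2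
      rw [he]
      exact ((cliqueCover_one hva.isClique_pair).union (cliqueCover_one (S := {b}) (by simp))).mono
        (fun w hw => by
          simp only [Finset.mem_union, Finset.mem_insert, Finset.mem_singleton] at hw ⊢
          tauto) le_rfl
    rw [hun]
    exact hN.union ((cliqueCover_one hT.isClique).union (cliqueCover_one hT'.isClique))
  push Not at h2
  have hdeg : ∀ v ∈ S, 3 ≤ (S.filter (H.Adj v)).card := fun v hv => by
    have := (hD.card_le_degree_add h3 ha hv).1
    have := h2 v hv
    omega
  have hcardQ := Finset.card_sdiff_add_card_eq_card hQS
  rw [hQ.card_eq] at hcardQ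
  have hdegQ : ∀ v ∈ S \ Q, 2 ≤ ((S \ Q).filter (H.Adj v)).card := fun v hv => by
    have hv' := Finset.mem_sdiff.1 hv
    have h5 := card_filter_le_of_subset_union (H := H) (Finset.union_sdiff_of_subset hQS).superset v
    have h6 := hD.card_neighbors_triangle_le h3 hQ hQS hv'.1 hv'.2
    have h7 := hdeg v hv'.1
    omega
  refine CliqueCover.add_clique hQ.isClique ?_
  by_cases htf : TriangleFreeOn H (S \ Q)
  · have hnot : ¬ IndepLE H (S \ Q) 2 := fun h => by
      have := htf.card_le_five h
      omega
    obtain ⟨x, hx, y, hy, z, hz, hxy, hxz, hyz, nxy, nxz, nyz⟩ : ∃ x ∈ S \ Q, ∃ y ∈ S \ Q,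
        ∃ z ∈ S \ Q, x ≠ y ∧ x ≠ z ∧ y ≠ z ∧ ¬ H.Adj x y ∧ ¬ H.Adj x z ∧ ¬ H.Adj y z := by
      by_contra! hc
      exact hnot (indepLE_two fun x hx y hy z hz h1 h2 h3 h4 h5 h6 =>
        h6 (hc x hx y hy z hz h1 h2 h3 h4 h5))
    set I : Finset V := {x, y, z} with hI
    have hIS : I ⊆ S \ Q := by simp only [hI, Finset.insert_subset_iff, Finset.singleton_subset_iff]; exact ⟨hx, hy, hz⟩
    have hI3 : I.card = 3 := Finset.card_eq_three.2 ⟨x, y, z, hxy, hxz, hyz, rfl⟩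
    have hJ := Finset.card_sdiff_add_card_eq_card hIS
    obtain ⟨p, q, r, hpq, hpr, hqr, hJe⟩ := Finset.card_eq_three.1 (by omega : ((S \ Q) \ I).card = 3)
    have hJmem : ∀ w, w ∈ ({p, q, r} : Finset V) → w ∈ S ∧ w ∉ I := fun w hw => by
      rw [← hJe] at hw
      exact ⟨(Finset.mem_sdiff.1 (Finset.mem_sdiff.1 hw).1).1, (Finset.mem_sdiff.1 hw).2⟩
    have hrow : ∀ w ∈ I, (∀ v ∈ I, ¬ H.Adj w v) → 2 ≤ (({p, q, r} : Finset V).filter (H.Adj w)).card := by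
      intro w hw hn
      have h5 := card_filter_le_of_subset_union (H := H) (Finset.union_sdiff_of_subset hIS).superset w
      have h6 : (I.filter (H.Adj w)).card = 0 := by
        rw [Finset.card_eq_zero]
        exact Finset.filter_eq_empty_iff.2 hn
      have h7 := hdegQ w (hIS hw)
      rw [hJe] at h5
      omega
    have hcol : ∀ w ∈ ({p, q, r} : Finset V), H.Adj x w ∨ H.Adj y w ∨ H.Adj z w := by
      intro w hw
      by_contra! hc
      have hwI := (hJmem w hw).2
      simp only [hI, Finset.mem_insert, Finset.mem_singleton, not_or] at hwI
      exact hc.2.2 (ha.adj_of_four (Finset.mem_sdiff.1 hx).1 (Finset.mem_sdiff.1 hy).1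
        (Finset.mem_sdiff.1 hz).1 (hJmem w hw).1 hxy hxz (Ne.symm hwI.1) hyz (Ne.symm hwI.2.1)
        (Ne.symm hwI.2.2) nxy nxz hc.1 nyz hc.2.1)
    have hsub : S \ Q ⊆ {x, y, z} ∪ {p, q, r} := by
      rw [← hJe, ← hI]
      exact (Finset.union_sdiff_of_subset hIS).superset
    have hsub' : ∀ p' q' r' : V, ({p, q, r} : Finset V) ⊆ {p', q', r'} →
        S \ Q ⊆ {x, y, z} ∪ {p', q', r'} := fun p' q' r' h =>
      hsub.trans (Finset.union_subset_union_right h)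
    have hperm : ∀ p' q' r' : V, H.Adj x p' ∧ H.Adj y q' ∧ H.Adj z r' →
        (∀ w, (w = p ∨ w = q ∨ w = r) → (w = p' ∨ w = q' ∨ w = r')) →
        CliqueCover H (S \ Q) 3 := fun p' q' r' h h' =>
      cliqueCover_three_pairs h.1 h.2.1 h.2.2 (hsub' p' q' r' fun w hw => by
        simp only [Finset.mem_insert, Finset.mem_singleton] at hw ⊢
        exact h' w hw)
    have := exists_transversal H.Adj (x := x) (y := y) (z := z) (p := p) (q := q) (r := r)
      (two_of_three (hrow x (by simp [hI]) (by simp [hI, nxy, nxz])))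
      (two_of_three (hrow y (by simp [hI]) (by simp [hI, nyz, H.adj_comm y x, nxy])))
      (two_of_three (hrow z (by simp [hI]) (by simp [hI, H.adj_comm z x, H.adj_comm z y, nxz, nyz])))
      (hcol p (by simp)) (hcol q (by simp)) (hcol r (by simp))
    rcases this with ⟨h1, ⟨h2, h3⟩ | ⟨h2, h3⟩⟩ | ⟨h1, ⟨h2, h3⟩ | ⟨h2, h3⟩⟩ | ⟨h1, ⟨h2, h3⟩ | ⟨h2, h3⟩⟩ <;>
      exact hperm _ _ _ ⟨h1, h2, h3⟩ fun v hv => by rcases hv with rfl | rfl | rfl <;> simp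
  · obtain ⟨Q', hQS', hQ'⟩ := not_triangleFreeOn htf
    refine CliqueCover.add_clique (k := 2) hQ'.isClique ?_
    have hc := Finset.card_sdiff_add_card_eq_card hQS'
    rw [hQ'.card_eq] at hc
    obtain ⟨x, hx⟩ : ((S \ Q) \ Q').Nonempty := Finset.card_pos.1 (by omega)
    have hx' := Finset.mem_sdiff.1 hx
    have h5 := card_filter_le_of_subset_union (H := H) (Finset.union_sdiff_of_subset hQS').superset x
    have h6 := hD.card_neighbors_triangle_le (h3.mono Finset.sdiff_subset) hQ' hQS' hx'.1 hx'.2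
    have h7 := hdegQ x hx'.1
    obtain ⟨y, hy⟩ := Finset.card_pos.1 (by omega : 0 < (((S \ Q) \ Q').filter (H.Adj x)).card)
    have hy := Finset.mem_filter.1 hy
    have h8 := card_sdiff_pair hx hy.1 hy.2.ne
    exact cliqueCover_pair_add hy.2 (cliqueCover_card (by omega))

/-- If every degree is at least four and no triangle is disjoint from the triangle `Q`, then the
vertices outside `Q` are paired off by the triangles that meet `Q`. -/
theorem DiamondFree.even_card_of_no_disjoint_triangle [DecidableRel H.Adj] (hD : DiamondFree H)
    (h3 : CliqueLE H S 3) (ha : IndepLE H S 3) {Q : Finset V} (hQS : Q ⊆ S) (hQ : H.IsNClique 3 Q)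
    (hdeg : ∀ v ∈ S, 4 ≤ (S.filter (H.Adj v)).card)
    (hno : ∀ T ⊆ S, H.IsNClique 3 T → ¬ Disjoint Q T) : Even (S \ Q).card := by
  have hex : ∀ v ∈ S \ Q, ∃ w ∈ S \ Q, ∃ q ∈ Q, H.Adj v w ∧ H.Adj v q ∧ H.Adj w q := by
    intro v hv
    have hv := Finset.mem_sdiff.1 hv
    obtain ⟨y, hy, z, hz, hvy, hvz, hyz⟩ := exists_triangle_of_degree ha (hdeg v hv.1)
    have h1 := hno {v, y, z} (by simp [Finset.insert_subset_iff, *])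
      (SimpleGraph.is3Clique_iff.2 ⟨v, y, z, hvy, hvz, hyz, rfl⟩)
    simp only [Finset.disjoint_insert_right, Finset.disjoint_singleton_right, hv.2,
      not_false_eq_true, true_and, not_and_or, not_not] at h1
    have huniq : ¬ (y ∈ Q ∧ z ∈ Q) := fun h =>
      hyz.ne (hD.eq_of_adj_triangle h3 hQ hQS hv.1 hv.2 h.1 h.2 hvy hvz)
    rcases h1 with h1 | h1
    · exact ⟨z, Finset.mem_sdiff.2 ⟨hz, fun e => huniq ⟨h1, e⟩⟩, y, h1, hvz, hvy, hyz.symm⟩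
    · exact ⟨y, Finset.mem_sdiff.2 ⟨hy, fun e => huniq ⟨e, h1⟩⟩, z, h1, hvy, hvz, hyz⟩
  choose! g hgm q hq hvg hvq hgq using hex
  -- The map `g` sends `v` to the third vertex of a triangle on `v` and `q v`; uniqueness of common
  -- neighbours makes it an involution.
  refine even_card_of_fixedPointFree _ g fun v hv => ⟨hgm v hv, (hvg v hv).ne', ?_⟩
  have hw := hgm v hv
  have hwS := Finset.mem_sdiff.1 hw
  have e : q (g v) = q v := hD.eq_of_adj_triangle h3 hQ hQS hwS.1 hwS.2 (hq _ hw) (hq v hv)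
    (hvq _ hw) (hgq v hv)
  exact hD.common_neighbor_unique h3 hwS.1 (hQS (hq v hv)) (Finset.mem_sdiff.1 (hgm _ hw)).1
    (Finset.mem_sdiff.1 hv).1 (hgq v hv) (hvg _ hw).symm (e ▸ hgq _ hw) (hvg v hv) (hvq v hv)

/-- Two disjoint triangles and an independent triple joined to each other are covered by three
triangles. -/
theorem DiamondFree.cliqueCover_triangles_triple (hD : DiamondFree H) (h3 : CliqueLE H S 3)
    (ha : IndepLE H S 3) {P Q : Finset V} (hPS : P ⊆ S) (hQS : Q ⊆ S) (hP : H.IsNClique 3 P)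
    (hQ : H.IsNClique 3 Q) (hPQ : Disjoint P Q) {x y z : V} (hxy : x ≠ y) (hxz : x ≠ z)
    (hyz : y ≠ z) (nxy : ¬ H.Adj x y) (nxz : ¬ H.Adj x z) (nyz : ¬ H.Adj y z)
    (hS : ∀ w ∈ ({x, y, z} : Finset V), w ∈ S ∧ w ∉ P ∧ w ∉ Q)
    (hxP : ∀ w ∈ ({x, y, z} : Finset V), ∃ p ∈ P, H.Adj w p)
    (hxQ : ∀ w ∈ ({x, y, z} : Finset V), ∃ q ∈ Q, H.Adj w q) :
    CliqueCover H ({x, y, z} ∪ (P ∪ Q)) 3 := by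
  classical
  have hni : ∀ v ∈ ({x, y, z} : Finset V), ∀ w ∈ ({x, y, z} : Finset V), ¬ H.Adj v w := by
    intro v hv w hw
    simp only [Finset.mem_insert, Finset.mem_singleton] at hv hw
    rcases hv with rfl | rfl | rfl <;> rcases hw with rfl | rfl | rfl <;> simp_all [H.adj_comm]
  have himage : ∀ R ⊆ S, H.IsNClique 3 R → (∀ w ∈ ({x, y, z} : Finset V), w ∉ R) →
      ∀ t : V → V, (∀ w ∈ ({x, y, z} : Finset V), t w ∈ R ∧ H.Adj w (t w)) →
      (∀ r ∈ R, ∃ w ∈ ({x, y, z} : Finset V), r = t w) ∧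
      Set.InjOn t (({x, y, z} : Finset V) : Set V) := by
    intro R hRS hR hn t ht
    -- A vertex of `R` outside the image would be independent from `x`, `y`, `z`.
    have hsurj : ∀ r ∈ R, ∃ w ∈ ({x, y, z} : Finset V), r = t w := by
      intro r hr
      by_contra! hc
      have hnadj : ∀ w ∈ ({x, y, z} : Finset V), ¬ H.Adj w r := fun w hw e => hc w hw
        (hD.eq_of_adj_triangle h3 hR hRS (hS w hw).1 (hn w hw) hr (ht w hw).1 e (ht w hw).2)
      have hne : ∀ w ∈ ({x, y, z} : Finset V), w ≠ r := fun w hw e => hn w hw (e ▸ hr)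
      exact hnadj z (by simp) (ha.adj_of_four (hS x (by simp)).1 (hS y (by simp)).1
        (hS z (by simp)).1 (hRS hr) hxy hxz (hne x (by simp)) hyz (hne y (by simp))
        (hne z (by simp)) nxy nxz (hnadj x (by simp)) nyz (hnadj y (by simp)))
    refine ⟨hsurj, Finset.injOn_of_card_image_eq ?_⟩
    have h1 : R ⊆ ({x, y, z} : Finset V).image t := fun r hr => by
      obtain ⟨w, hw, e⟩ := hsurj r hr
      exact Finset.mem_image.2 ⟨w, hw, e.symm⟩
    have h2 := Finset.card_le_card h1
    have h4 : (({x, y, z} : Finset V).image t).card ≤ _ := Finset.card_image_le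
    rw [hR.card_eq] at h2
    rw [Finset.card_eq_three.2 ⟨x, y, z, hxy, hxz, hyz, rfl⟩] at h4 ⊢
    omega
  choose! p hp hwp using hxP
  choose! q hq hwq using hxQ
  obtain ⟨hps, hpi⟩ := himage P hPS hP (fun w hw => (hS w hw).2.1) p fun w hw => ⟨hp w hw, hwp w hw⟩
  obtain ⟨hqs, hqi⟩ := himage Q hQS hQ (fun w hw => (hS w hw).2.2) q fun w hw => ⟨hq w hw, hwq w hw⟩
  -- Otherwise `u`, `v`, `p w`, `q w` would be independent.
  have hpq : ∀ w ∈ ({x, y, z} : Finset V), ∀ u ∈ ({x, y, z} : Finset V),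
      ∀ v ∈ ({x, y, z} : Finset V), u ≠ v → u ≠ w → v ≠ w → H.Adj (p w) (q w) := by
    intro w hw u hu v hv huv huw hvw
    have h1 : ∀ u ∈ ({x, y, z} : Finset V), u ≠ w → ¬ H.Adj u (p w) := fun u hu huw e =>
      huw (hpi hu hw (hD.eq_of_adj_triangle h3 hP hPS (hS u hu).1 (hS u hu).2.1 (hp u hu) (hp w hw)
        (hwp u hu) e))
    have h2 : ∀ u ∈ ({x, y, z} : Finset V), u ≠ w → ¬ H.Adj u (q w) := fun u hu huw e =>
      huw (hqi hu hw (hD.eq_of_adj_triangle h3 hQ hQS (hS u hu).1 (hS u hu).2.2 (hq u hu) (hq w hw)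
        (hwq u hu) e))
    exact ha.adj_of_four (hS u hu).1 (hS v hv).1 (hPS (hp w hw)) (hQS (hq w hw)) huv
      (fun e => (hS u hu).2.1 (e ▸ hp w hw)) (fun e => (hS u hu).2.2 (e ▸ hq w hw))
      (fun e => (hS v hv).2.1 (e ▸ hp w hw)) (fun e => (hS v hv).2.2 (e ▸ hq w hw))
      (fun e => Finset.disjoint_left.1 hPQ (hp w hw) (e ▸ hq w hw)) (hni u hu v hv)
      (h1 u hu huw) (h2 u hu huw) (h1 v hv hvw) (h2 v hv hvw)
  have hcl : ∀ w ∈ ({x, y, z} : Finset V), H.Adj (p w) (q w) →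
      CliqueCover H {w, p w, q w} 1 := fun w hw e => cliqueCover_one
    (SimpleGraph.is3Clique_iff.2 ⟨w, p w, q w, hwp w hw, hwq w hw, e, rfl⟩ : H.IsNClique 3 _).isClique
  refine (((hcl x (by simp) (hpq x (by simp) y (by simp) z (by simp) hyz hxy.symm hxz.symm)).union
    (hcl y (by simp) (hpq y (by simp) x (by simp) z (by simp) hxz hxy hyz.symm))).union
    (hcl z (by simp) (hpq z (by simp) x (by simp) y (by simp) hxy hxz hyz))).mono ?_ le_rfl
  intro w hw
  rcases Finset.mem_union.1 hw with hw | hw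
  · simp only [Finset.mem_union, Finset.mem_insert, Finset.mem_singleton] at hw ⊢
    tauto
  rcases Finset.mem_union.1 hw with hw | hw
  · obtain ⟨u, hu, rfl⟩ := hps w hw
    simp only [Finset.mem_union, Finset.mem_insert, Finset.mem_singleton] at hu ⊢
    rcases hu with rfl | rfl | rfl <;> tauto
  · obtain ⟨u, hu, rfl⟩ := hqs w hw
    simp only [Finset.mem_union, Finset.mem_insert, Finset.mem_singleton] at hu ⊢
    rcases hu with rfl | rfl | rfl <;> tauto

/-- Two disjoint triangles come from a vertex of degree three, or else from parity, since seven
vertices cannot be paired off. The four remaining vertices either have a perfect matching or form a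
star. -/
theorem DiamondFree.cliqueCover_of_card_eq_ten (hD : DiamondFree H) (h3 : CliqueLE H S 3)
    (ha : IndepLE H S 3) {Q : Finset V} (hQS : Q ⊆ S) (hQ : H.IsNClique 3 Q) (h10 : S.card = 10) :
    CliqueCover H S 4 := by
  classical
  have hdeg : ∀ v ∈ S, 3 ≤ (S.filter (H.Adj v)).card := fun v hv => by
    have := (hD.card_le_degree_add h3 ha hv).1
    omega
  obtain ⟨P, R, hPS, hRS, hP, hR, hPR⟩ : ∃ P R : Finset V, P ⊆ S ∧ R ⊆ S ∧ H.IsNClique 3 P ∧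
      H.IsNClique 3 R ∧ Disjoint P R := by
    by_cases h4 : ∃ v ∈ S, (S.filter (H.Adj v)).card = 3
    · obtain ⟨v, hv, hd⟩ := h4
      obtain ⟨P, R, hPS, hRS, hP, hR, hPR, -⟩ := (hD.card_le_degree_add h3 ha hv).2 (by omega)
      exact ⟨P, R, hPS, hRS, hP, hR, hPR⟩
    · push Not at h4
      by_contra! hc
      obtain ⟨m, hm⟩ := hD.even_card_of_no_disjoint_triangle h3 ha hQS hQ (fun v hv => by
        have := hdeg v hv
        have := h4 v hv
        omega) fun T hT hT3 => hc Q T hQS hT hQ hT3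
      have := Finset.card_sdiff_add_card_eq_card hQS
      rw [hQ.card_eq] at this
      omega
  have hPRS : P ∪ R ⊆ S := Finset.union_subset hPS hRS
  have hcard := Finset.card_sdiff_add_card_eq_card hPRS
  rw [Finset.card_union_of_disjoint hPR, hP.card_eq, hR.card_eq] at hcard
  have hL : ∀ w ∈ S \ (P ∪ R), w ∈ S ∧ w ∉ P ∧ w ∉ R := fun w hw => by
    simpa [not_or] using hw
  have hsplit : ∀ w ∈ S \ (P ∪ R), 3 ≤ ((S \ (P ∪ R)).filter (H.Adj w)).card +
      (P.filter (H.Adj w)).card + (R.filter (H.Adj w)).card ∧ (P.filter (H.Adj w)).card ≤ 1 ∧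
      (R.filter (H.Adj w)).card ≤ 1 := fun w hw => by
    obtain ⟨hwS, hwP, hwR⟩ := hL w hw
    have h1 := card_filter_le_of_subset_union (H := H) (Finset.union_sdiff_of_subset hPRS).superset w
    have h2 := card_filter_le_of_subset_union (H := H) (subset_refl (P ∪ R)) w
    have h4 := hdeg w hwS
    exact ⟨by omega, hD.card_neighbors_triangle_le h3 hP hPS hwS hwP,
      hD.card_neighbors_triangle_le h3 hR hRS hwS hwR⟩
  have hnbr : ∀ w ∈ S \ (P ∪ R), ∃ v ∈ S \ (P ∪ R), H.Adj w v := fun w hw => by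
    obtain ⟨h1, h2, h4⟩ := hsplit w hw
    obtain ⟨v, hv⟩ := Finset.card_pos.1 (by omega : 0 < ((S \ (P ∪ R)).filter (H.Adj w)).card)
    exact ⟨v, (Finset.mem_filter.1 hv).1, (Finset.mem_filter.1 hv).2⟩
  have hfin : CliqueCover H (S \ (P ∪ R)) 2 → CliqueCover H S 4 := fun h =>
    (h.union ((cliqueCover_one hP.isClique).union (cliqueCover_one hR.isClique))).mono
      (Finset.sdiff_union_of_subset hPRS).superset le_rfl
  -- A leaf has at most one neighbour among the four, so degree three gives it one in each triangle.
  -- The leaves and both triangles then regroup into three triangles, and the centre stands alone.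
  have hstar : ∀ c x y z : V, S \ (P ∪ R) = {c, x, y, z} → x ≠ y → x ≠ z → y ≠ z →
      ¬ H.Adj x y → ¬ H.Adj x z → ¬ H.Adj y z → CliqueCover H S 4 := by
    intro c x y z he hxy hxz hyz nxy nxz nyz
    have hmem : ∀ w ∈ ({x, y, z} : Finset V), w ∈ S \ (P ∪ R) := fun w hw => by
      rw [he]; exact Finset.mem_insert_of_mem hw
    have hone : ∀ w ∈ ({x, y, z} : Finset V), 1 ≤ (P.filter (H.Adj w)).card ∧
        1 ≤ (R.filter (H.Adj w)).card := by
      intro w hw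
      obtain ⟨h1, h2, h4⟩ := hsplit w (hmem w hw)
      have h5 : ((S \ (P ∪ R)).filter (H.Adj w)).card ≤ 1 := by
        have : (S \ (P ∪ R)).filter (H.Adj w) ⊆ {c} := by
          intro v hv
          simp only [he, Finset.mem_filter, Finset.mem_insert, Finset.mem_singleton] at hv hw ⊢
          obtain ⟨rfl | rfl | rfl | rfl, hv⟩ := hv <;> rcases hw with rfl | rfl | rfl <;>
            simp_all [H.adj_comm]
        exact (Finset.card_le_card this).trans (by simp)
      omega
    have hcov := hD.cliqueCover_triangles_triple h3 ha hPS hRS hP hR hPR hxy hxz hyz nxy nxz nyz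
      (fun w hw => hL w (hmem w hw))
      (fun w hw => by
        obtain ⟨p, hp⟩ := Finset.card_pos.1 (hone w hw).1
        exact ⟨p, (Finset.mem_filter.1 hp).1, (Finset.mem_filter.1 hp).2⟩)
      (fun w hw => by
        obtain ⟨p, hp⟩ := Finset.card_pos.1 (hone w hw).2
        exact ⟨p, (Finset.mem_filter.1 hp).1, (Finset.mem_filter.1 hp).2⟩)
    refine (hcov.union (cliqueCover_one (S := {c}) (by simp))).mono (fun w hw => ?_) le_rfl
    by_cases hw' : w ∈ P ∪ R
    · exact Finset.mem_union_left _ (Finset.mem_union_right _ hw')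
    · have : w ∈ S \ (P ∪ R) := Finset.mem_sdiff.2 ⟨hw, hw'⟩
      rw [he] at this
      simp only [Finset.mem_union, Finset.mem_insert, Finset.mem_singleton] at this ⊢
      tauto
  obtain ⟨x, hx⟩ : (S \ (P ∪ R)).Nonempty := Finset.card_pos.1 (by omega)
  obtain ⟨y, hy, hxy⟩ := hnbr x hx
  have h4 := card_sdiff_pair hx hy hxy.ne
  obtain ⟨z, w, hzw, he⟩ := Finset.card_eq_two.1 (by omega : ((S \ (P ∪ R)) \ {x, y}).card = 2)
  have hLe : S \ (P ∪ R) = {x, y, z, w} := by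
    have := Finset.union_sdiff_of_subset
      (show ({x, y} : Finset V) ⊆ S \ (P ∪ R) by
        simp only [Finset.insert_subset_iff, Finset.singleton_subset_iff]; exact ⟨hx, hy⟩)
    rw [← this, he]
    ext v
    simp only [Finset.mem_union, Finset.mem_insert, Finset.mem_singleton]
    tauto
  have hz : z ∈ (S \ (P ∪ R)) \ {x, y} := by rw [he]; simp
  have hw : w ∈ (S \ (P ∪ R)) \ {x, y} := by rw [he]; simp
  have hz' := Finset.mem_sdiff.1 hz
  have hw' := Finset.mem_sdiff.1 hw
  have hzn := hz'.2
  have hwn := hw'.2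
  simp only [Finset.mem_insert, Finset.mem_singleton, not_or] at hzn hwn
  have hpairs : ∀ a b c d : V, H.Adj a b → H.Adj c d → (∀ v, v = x ∨ v = y ∨ v = z ∨ v = w →
      (v = a ∨ v = b) ∨ v = c ∨ v = d) → CliqueCover H S 4 := fun a b c d hab hcd h => by
    refine hfin (((cliqueCover_one hab.isClique_pair).union
      (cliqueCover_one hcd.isClique_pair)).mono (fun v hv => ?_) le_rfl)
    rw [hLe] at hv
    simp only [Finset.mem_union, Finset.mem_insert, Finset.mem_singleton] at hv ⊢
    exact h v hv
  by_cases azw : H.Adj z w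
  · exact hpairs x y z w hxy azw fun v hv => by rcases hv with rfl | rfl | rfl | rfl <;> simp
  have hz2 : H.Adj z x ∨ H.Adj z y := by
    obtain ⟨v, hv, hzv⟩ := hnbr z hz'.1
    rw [hLe] at hv
    simp only [Finset.mem_insert, Finset.mem_singleton] at hv
    rcases hv with rfl | rfl | rfl | rfl
    · exact Or.inl hzv
    · exact Or.inr hzv
    · exact absurd hzv H.irrefl
    · exact absurd hzv azw
  have hw2 : H.Adj w x ∨ H.Adj w y := by
    obtain ⟨v, hv, hwv⟩ := hnbr w hw'.1
    rw [hLe] at hv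
    simp only [Finset.mem_insert, Finset.mem_singleton] at hv
    rcases hv with rfl | rfl | rfl | rfl
    · exact Or.inl hwv
    · exact Or.inr hwv
    · exact absurd hwv.symm azw
    · exact absurd hwv H.irrefl
  by_cases h1 : H.Adj z x ∧ H.Adj w y
  · exact hpairs z x w y h1.1 h1.2 fun v hv => by rcases hv with rfl | rfl | rfl | rfl <;> simp
  by_cases h2 : H.Adj z y ∧ H.Adj w x
  · exact hpairs z y w x h2.1 h2.2 fun v hv => by rcases hv with rfl | rfl | rfl | rfl <;> simp
  by_cases h5 : H.Adj z x
  · have h6 : ¬ H.Adj w y := fun e => h1 ⟨h5, e⟩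
    have h7 : ¬ H.Adj z y := fun e => h2 ⟨e, hw2.resolve_right h6⟩
    exact hstar x y z w hLe (Ne.symm hzn.2) (Ne.symm hwn.2) hzw (fun e => h7 e.symm)
      (fun e => h6 e.symm) azw
  · have h6 : ¬ H.Adj w x := fun e => h2 ⟨hz2.resolve_left h5, e⟩
    exact hstar y x z w (by rw [hLe, Finset.insert_comm]) (Ne.symm hzn.1) (Ne.symm hwn.1) hzw
      (fun e => h5 e.symm) (fun e => h6 e.symm) azw

theorem DiamondFree.cliqueCover_four (hD : DiamondFree H) (h3 : CliqueLE H S 3)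
    (ha : IndepLE H S 3) {Q : Finset V} (hQS : Q ⊆ S) (hQ : H.IsNClique 3 Q) :
    CliqueCover H S 4 := by
  have h10 := hD.card_le_ten h3 ha
  by_cases h : S.card = 10
  · exact hD.cliqueCover_of_card_eq_ten h3 ha hQS hQ h
  by_cases h' : S.card = 9
  · exact hD.cliqueCover_of_card_eq_nine h3 ha hQS hQ h'
  have := Finset.card_sdiff_add_card_eq_card hQS
  rw [hQ.card_eq] at this
  exact (cliqueCover_of_card_le_five (ha.mono Finset.sdiff_subset le_rfl) (by omega)).add_clique
    hQ.isClique

end SmallCase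

/-! ### The induction on maximum cliques and the return to `G` -/

section Main

variable {V : Type*} [DecidableEq V] {H : SimpleGraph V} {S : Finset V}

theorem exists_max_clique (H : SimpleGraph V) (S : Finset V) :
    ∃ Q ⊆ S, H.IsClique (Q : Set V) ∧ CliqueLE H S Q.card := by
  classical
  obtain ⟨K, hK, hmax⟩ := (S.powerset.filter fun K : Finset V => H.IsClique (K : Set V)).exists_max_image
    Finset.card ⟨∅, by simp⟩
  simp only [Finset.mem_filter, Finset.mem_powerset] at hK hmax
  exact ⟨K, hK.1, hK.2, fun L hL hi => hmax L ⟨hL, hi⟩⟩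

/-- A maximum independent set disjoint from a maximum clique `Q` with at least three vertices forces
both to have three vertices. -/
theorem card_eq_three_of_disjoint (hD : DiamondFree H) (hP : NoEdgeWithTriple H) {a : ℕ}
    (ha : IndepLE H S a) {Q K : Finset V} (hQS : Q ⊆ S) (hQ : H.IsClique (Q : Set V))
    (hmax : CliqueLE H S Q.card) (h3 : 3 ≤ Q.card) (hKS : K ⊆ S \ Q)
    (hK : H.IsIndepSet (K : Set V)) (hKa : K.card = a) : a = 3 ∧ Q.card = 3 := by
  classical
  have hKQ : ∀ x ∈ K, x ∈ S ∧ x ∉ Q := fun x hx => Finset.mem_sdiff.1 (hKS hx)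
  have hnbr : ∀ q ∈ Q, ∃ y ∈ K, H.Adj q y := by
    intro q hq
    by_contra! hc
    have := ha (insert q K) (Finset.insert_subset (hQS hq) fun x hx => (hKQ x hx).1) (by
      intro x hx y hy hne
      rw [Finset.coe_insert, Set.mem_insert_iff, Finset.mem_coe] at hx hy
      rcases hx with rfl | hx <;> rcases hy with rfl | hy
      · exact absurd rfl hne
      · exact hc y hy
      · exact fun e => hc x hx e.symm
      · exact hK hx hy hne)
    rw [Finset.card_insert_of_notMem fun e => (hKQ q e).2 hq] at this
    omega
  have hcount : ∀ q ∈ Q, max 1 (a - 2) ≤ (K.filter (H.Adj q)).card := by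
    intro q hq
    obtain ⟨y, hy, hqy⟩ := hnbr q hq
    have h1 : 1 ≤ (K.filter (H.Adj q)).card :=
      Finset.card_pos.2 ⟨y, Finset.mem_filter.2 ⟨hy, hqy⟩⟩
    -- The edge `q y` would miss any three non-neighbours of `q` in `K`, because `y` lies in the
    -- independent set `K`.
    have h2 : (K.filter fun x => ¬ H.Adj q x).card ≤ 2 := by
      by_contra! hc
      obtain ⟨u, v, w, hu, hv, hw, huv, huw, hvw⟩ := Finset.two_lt_card_iff.1 hc
      simp only [Finset.mem_filter] at hu hv hw
      have key : ∀ x ∈ K, ¬ H.Adj y x := fun x hx e => hK hy hx e.ne e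
      exact hP hqy huv huw hvw (hK hu.1 hv.1 huv) (hK hu.1 hw.1 huw) (hK hv.1 hw.1 hvw) hu.2 hv.2
        hw.2 (key u hu.1) (key v hv.1) (key w hw.1)
    have h4 := Finset.card_filter_add_card_filter_not (s := K) (H.Adj q)
    omega
  have hle := card_mul_le_of_unique_neighbor (H := H) (K := K) (fun y hy p hp q hq h1 h2 =>
    hD.eq_of_adj_clique hQ hQS hmax (hKQ y hy).1 (hKQ y hy).2 hp hq h1 h2) hcount
  rw [hKa] at hle
  -- From 3 max(1, a - 2) ≤ a one gets a = 3, and then |Q| ≤ a gives |Q| = 3.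
  have h5 : 3 * max 1 (a - 2) ≤ Q.card * max 1 (a - 2) := Nat.mul_le_mul_right _ h3
  have h6 : Q.card * 1 ≤ Q.card * max 1 (a - 2) := Nat.mul_le_mul_left _ (le_max_left _ _)
  omega

theorem cliqueCover_of_indepLE (hD : DiamondFree H) (hP : NoEdgeWithTriple H) {a : ℕ}
    (ha : IndepLE H S a) : CliqueCover H S (a + 1) := by
  induction hn : S.card using Nat.strong_induction_on generalizing S a with
  | _ n ih =>
  subst hn
  by_cases htf : TriangleFreeOn H S
  · exact (htf.matchingLE hP ha).cliqueCover
  obtain ⟨T, hTS, hT⟩ := not_triangleFreeOn htf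
  obtain ⟨Q, hQS, hQ, hmax⟩ := exists_max_clique H S
  have h3 : 3 ≤ Q.card := hT.card_eq ▸ hmax T hTS hT.isClique
  have hcard := Finset.card_sdiff_add_card_eq_card hQS
  obtain ⟨K, hKS, hK, hKmax⟩ := exists_indepLE H (S \ Q)
  have hKa : K.card ≤ a := ha K (hKS.trans Finset.sdiff_subset) hK
  by_cases he : K.card = a
  · obtain ⟨rfl, hQ3⟩ := card_eq_three_of_disjoint hD hP ha hQS hQ hmax h3 hKS hK he
    exact hD.cliqueCover_four (hQ3 ▸ hmax) ha hQS ⟨hQ, hQ3⟩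
  · exact (ih (S \ Q).card (by omega) hKmax rfl).add_clique hQ |>.mono subset_rfl (by omega)

/-- The edge `u v` of the complement plays the deleted edge of K₅. -/
theorem noEdgeWithTriple_compl {G : SimpleGraph V}
    (h : ¬ SimpleGraph.IsIndContained K5MinusEdge G) : NoEdgeWithTriple Gᶜ := by
  intro u v x y z huv hxy hxz hyz h1 h2 h3 h4 h5 h6 h7 h8 h9
  have hux : u ≠ x := fun e => h7 (e ▸ huv.symm)
  have huy : u ≠ y := fun e => h8 (e ▸ huv.symm)
  have huz : u ≠ z := fun e => h9 (e ▸ huv.symm)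
  have hvx : v ≠ x := fun e => h4 (e ▸ huv)
  have hvy : v ≠ y := fun e => h5 (e ▸ huv)
  have hvz : v ≠ z := fun e => h6 (e ▸ huv)
  simp only [SimpleGraph.compl_adj, not_and, not_not] at huv h1 h2 h3 h4 h5 h6 h7 h8 h9
  replace h1 := h1 hxy
  replace h2 := h2 hxz
  replace h3 := h3 hyz
  replace h4 := h4 hux
  replace h5 := h5 huy
  replace h6 := h6 huz
  replace h7 := h7 hvx
  replace h8 := h8 hvy
  replace h9 := h9 hvz
  refine h ⟨⟨⟨![u, v, x, y, z], ?_⟩, ?_⟩⟩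
  · intro i j hij
    fin_cases i <;> fin_cases j <;> simp_all
  · intro i j
    change G.Adj (![u, v, x, y, z] i) (![u, v, x, y, z] j) ↔ _
    fin_cases i <;> fin_cases j <;> simp_all [K5MinusEdge, G.adj_comm]

/-- The missing edge `a d` of a diamond in the complement becomes the single edge of K₂ ∪ 2K₁, and
`b`, `c` become its isolated vertices. -/
theorem diamondFree_compl {G : SimpleGraph V}
    (h : ¬ SimpleGraph.IsIndContained K2Union2K1 G) : DiamondFree Gᶜ := by
  intro a b c d hbc hab hac hdb hdc hne
  by_contra had
  have had' : G.Adj a d := by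
    by_contra e
    exact had ⟨hne, e⟩
  simp only [SimpleGraph.compl_adj] at hbc hab hac hdb hdc
  refine h ⟨⟨⟨Sum.elim ![a, d] ![b, c], ?_⟩, ?_⟩⟩
  · rintro (i | i) (j | j) hij <;> fin_cases i <;> fin_cases j <;> simp_all
  · intro i j
    change G.Adj (Sum.elim ![a, d] ![b, c] i) (Sum.elim ![a, d] ![b, c] j) ↔ _
    obtain i | i := i <;> obtain j | j := j <;> fin_cases i <;> fin_cases j <;> simp_all [K2Union2K1, G.adj_comm]

end Main

theorem theorem4 {V : Type*} [Finite V] (G : SimpleGraph V)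
    (h₁ : ¬ SimpleGraph.IsIndContained K5MinusEdge G)
    (h₂ : ¬ SimpleGraph.IsIndContained K2Union2K1 G) :
    G.chromaticNumber ≤ (G.cliqueNum : ℕ∞) + 1 := by
  classical
  have := Fintype.ofFinite V
  have ha : IndepLE Gᶜ Finset.univ G.cliqueNum := fun K _ hK =>
    SimpleGraph.IsClique.card_le_cliqueNum (tc := (SimpleGraph.isIndepSet_compl G).1 hK)
  obtain ⟨c, hc, hadj⟩ := cliqueCover_of_indepLE (diamondFree_compl h₂) (noEdgeWithTriple_compl h₁) ha
  have hcol : G.Colorable (G.cliqueNum + 1) :=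
    ⟨SimpleGraph.Coloring.mk (fun v => ⟨c v, hc v (Finset.mem_univ v)⟩) fun {v w} hvw e =>
      (hadj v (Finset.mem_univ v) w (Finset.mem_univ w) hvw.ne (Fin.mk.inj_iff.1 e)).2 hvw⟩
  exact_mod_cast hcol.chromaticNumber_le
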